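/- Let $\mathcal{F}_2$ be the family of entire functions $h:\mathbb{C}\to\mathbb{C}$ of exponential type at most $\pi$ (that is, for every $\varepsilon>0$ there is $C_\varepsilon>0$ with $|h(z)|\le C_\varepsilon e^{(\pi+\varepsilon)|z|}$ for all $z\in\mathbb{C}$) such that $xh\in L^2(\mathbb{R})$ and $|h(x)|=|h(-x)|$ for all $x\in\mathbb{R}$. Let $\mathcal{E}=\{h\in\mathcal{F}_2:\ h \text{ is even}\}$, a complex vector space with the inner product $$\langle f,g\rangle=\langle xf,xg\rangle_{L^2(\mathbb{R})}=\int_{-\infty}^{\infty}x^2 f(x)\overline{g(x)}\,dx .$$ For odd integers $k\ge 1$ let $$h_k(z)=\frac{4\sqrt2\,\cos(\pi z)}{\pi\,(k^2-4z^2)},$$ where the removable singularities at $z=\pm k/2$ are filled by the limit value $\sqrt2\,\sin(\pi k/2)/k$. **Proposition.** The space $\mathcal{E}$ is complete, that is, a Hilbert space (equivalently, its image under $h\mapsto xh$ is a closed subspace of $L^2(\mathbb{R})$). Every $h_k$ with $k\ge1$ odd belongs to $\mathcal{E}$, and the family $(h_k)_{k\ge 1,\ k\text{ odd}}$ is a complete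 orthonormal system in $\mathcal{E}$: $\langle h_j,h_k\rangle=\delta_{jk}$ for all odd $j,k\ge1$, and the linear span of the $h_k$ is dense in $\mathcal{E}$. -/

import Mathlib

open MeasureTheory

noncomputable section

namespace PaleyWienerEven

/-- `f` has exponential type at most `τ`: for all `ε > 0` there is `C > 0` with
`|f z| ≤ C exp ((τ + ε) |z|)` on `ℂ`. -/
def HasExpTypeAtMost (f : ℂ → ℂ) (τ : ℝ) : Prop :=
  ∀ ε : ℝ, 0 < ε → ∃ C : ℝ, 0 < C ∧ ∀ z : ℂ, ‖f z‖ ≤ C * Real.exp ((τ + ε) * ‖z‖)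

/-- The function `x ↦ x h(x)` on the real line. -/
def mulX (h : ℂ → ℂ) : ℝ → ℂ := fun x => (x : ℂ) * h (x : ℂ)

/-- The family `𝓕₂`: entire functions `h` of exponential type at most `π` such that
`x h ∈ L²(ℝ)` and `|h(x)| = |h(-x)|` for real `x`. -/
def F2 : Set (ℂ → ℂ) :=
  {h | Differentiable ℂ h ∧ HasExpTypeAtMost h Real.pi ∧ MemLp (mulX h) 2 (volume : Measure ℝ) ∧
    ∀ x : ℝ, ‖h (x : ℂ)‖ = ‖h (-(x : ℂ))‖}

/-- The even elements of `𝓕₂`. -/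
def evenF2 : Set (ℂ → ℂ) := {h | h ∈ F2 ∧ ∀ z : ℂ, h (-z) = h z}

theorem HasExpTypeAtMost.add {f g : ℂ → ℂ} {τ : ℝ} (hf : HasExpTypeAtMost f τ)
    (hg : HasExpTypeAtMost g τ) : HasExpTypeAtMost (f + g) τ := by
  intro ε hε
  obtain ⟨C, hC, h1⟩ := hf ε hε
  obtain ⟨D, hD, h2⟩ := hg ε hε
  refine ⟨C + D, by positivity, fun z => ?_⟩
  calc ‖(f + g) z‖ ≤ ‖f z‖ + ‖g z‖ := norm_add_le _ _
    _ ≤ (C + D) * Real.exp ((τ + ε) * ‖z‖) := by nlinarith [h1 z, h2 z]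

theorem HasExpTypeAtMost.smul {f : ℂ → ℂ} {τ : ℝ} (c : ℂ) (hf : HasExpTypeAtMost f τ) :
    HasExpTypeAtMost (c • f) τ := by
  intro ε hε
  obtain ⟨C, hC, h1⟩ := hf ε hε
  refine ⟨(‖c‖ + 1) * C, by positivity, fun z => ?_⟩
  have h2 : 0 ≤ C * Real.exp ((τ + ε) * ‖z‖) := by positivity
  calc ‖(c • f) z‖ = ‖c‖ * ‖f z‖ := by simp
    _ ≤ (‖c‖ + 1) * (C * Real.exp ((τ + ε) * ‖z‖)) :=
        mul_le_mul (by linarith) (h1 z) (norm_nonneg _) (by positivity)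
    _ = _ := by ring

theorem mulX_add (f g : ℂ → ℂ) : mulX (f + g) = mulX f + mulX g := by
  ext x; simp [mulX, mul_add]

theorem mulX_smul (c : ℂ) (f : ℂ → ℂ) : mulX (c • f) = c • mulX f := by
  ext x; simp [mulX]; ring

/-- The even elements of `𝓕₂` form a complex vector space. -/
def evenF2Submodule : Submodule ℂ (ℂ → ℂ) where
  carrier := evenF2
  zero_mem' := by
    refine ⟨⟨differentiable_const _, ?_, ?_, by simp⟩, by simp⟩
    · intro ε hε
      exact ⟨1, one_pos, fun z => by simp; positivity⟩
    · have : mulX 0 = 0 := by ext x; simp [mulX]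
      rw [this]
      exact MemLp.zero
  add_mem' := by
    rintro f g ⟨⟨hf1, hf2, hf3, -⟩, hf5⟩ ⟨⟨hg1, hg2, hg3, -⟩, hg5⟩
    refine ⟨⟨hf1.add hg1, hf2.add hg2, ?_, ?_⟩, ?_⟩
    · rw [mulX_add]; exact hf3.add hg3
    · intro x; simp [hf5, hg5]
    · intro z; simp [hf5, hg5]
  smul_mem' := by
    rintro c f ⟨⟨hf1, hf2, hf3, -⟩, hf5⟩
    refine ⟨⟨hf1.const_smul c, hf2.smul c, ?_, ?_⟩, ?_⟩
    · rw [mulX_smul]; exact hf3.const_smul c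
    · intro x; simp [hf5]
    · intro z; simp [hf5]

/-- The space of even elements of `𝓕₂`, as a type of its own: its topology is the one given by
the inner product below, not the topology of pointwise convergence. -/
def EvenF2 : Type := evenF2Submodule

instance : AddCommGroup EvenF2 := inferInstanceAs (AddCommGroup evenF2Submodule)

instance : Module ℂ EvenF2 := inferInstanceAs (Module ℂ evenF2Submodule)

/-- An even element of `𝓕₂` as a point of the space `EvenF2`. -/
def EvenF2.mk (h : ℂ → ℂ) (hh : h ∈ evenF2) : EvenF2 := (⟨h, hh⟩ : evenF2Submodule)

/-- The underlying function. -/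
def EvenF2.fn (f : EvenF2) : ℂ → ℂ := Subtype.val (p := fun h => h ∈ evenF2Submodule) f

theorem EvenF2.fn_mem (f : EvenF2) : f.fn ∈ evenF2 :=
  Subtype.property (p := fun h => h ∈ evenF2Submodule) f

theorem EvenF2.memLp (f : EvenF2) : MemLp (mulX f.fn) 2 (volume : Measure ℝ) :=
  f.fn_mem.1.2.2.1

/-- The linear map `h ↦ x h` into `L²(ℝ)`. -/
def toL2 : EvenF2 →ₗ[ℂ] Lp ℂ 2 (volume : Measure ℝ) where
  toFun f := f.memLp.toLp (mulX f.fn)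
  map_add' f g := by
    rw [← MemLp.toLp_add]
    exact MemLp.toLp_congr _ _ (Filter.EventuallyEq.of_eq (mulX_add f.fn g.fn))
  map_smul' c f := by
    rw [RingHom.id_apply, ← MemLp.toLp_const_smul]
    exact MemLp.toLp_congr _ _ (Filter.EventuallyEq.of_eq (mulX_smul c f.fn))

theorem eq_zero_of_toL2_eq_zero (f : EvenF2) (hf : toL2 f = 0) : f = 0 := by
  have hd : Differentiable ℂ f.fn := f.fn_mem.1.1
  have hc : Continuous (mulX f.fn) :=
    Complex.continuous_ofReal.mul (hd.continuous.comp Complex.continuous_ofReal)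
  have h0 : mulX f.fn =ᵐ[volume] (0 : ℝ → ℂ) := by
    have h1 : mulX f.fn =ᵐ[volume] (toL2 f : ℝ → ℂ) := (MemLp.coeFn_toLp f.memLp).symm
    rw [hf] at h1
    exact h1.trans (Lp.coeFn_zero _ _ _)
  have h2 : mulX f.fn = 0 := Continuous.ae_eq_iff_eq volume hc continuous_zero |>.1 h0
  have h3 : ∀ x : ℝ, x ≠ 0 → f.fn (x : ℂ) = 0 := by
    intro x hx
    have := congrFun h2 x
    simpa [mulX, hx] using this
  have h4 : f.fn = 0 := by
    have han : AnalyticOnNhd ℂ f.fn Set.univ := fun z _ => hd.analyticAt z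
    have han0 : AnalyticOnNhd ℂ (0 : ℂ → ℂ) Set.univ := fun z _ => analyticAt_const
    refine han.eq_of_frequently_eq (z₀ := 0) han0 ?_
    have ht : Filter.Tendsto (fun x : ℝ => (x : ℂ)) (nhdsWithin 0 {0}ᶜ) (nhdsWithin 0 {0}ᶜ) := by
      refine tendsto_nhdsWithin_iff.2 ⟨?_, ?_⟩
      · have := (Complex.continuous_ofReal.tendsto (0 : ℝ)).mono_left
          (nhdsWithin_le_nhds (s := ({0}ᶜ : Set ℝ)))
        simpa using this
      · filter_upwards [self_mem_nhdsWithin] with x hx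
        simpa using hx
    refine ht.frequently (Filter.Eventually.frequently ?_)
    filter_upwards [self_mem_nhdsWithin] with x hx
    exact h3 x hx
  exact Subtype.ext h4

/-- The inner product `⟨f, g⟩ = ⟨x f, x g⟩` of `L²(ℝ)`, with Mathlib's convention that it is
conjugate-linear in the first argument. -/
@[reducible] def innerCore : InnerProductSpace.Core ℂ EvenF2 where
  inner f g := inner ℂ (toL2 f) (toL2 g)
  conj_inner_symm f g := inner_conj_symm _ _
  re_inner_nonneg f := inner_self_nonneg (𝕜 := ℂ) (x := toL2 f)
  add_left f g h := by rw [map_add, inner_add_left]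
  smul_left f g c := by rw [map_smul, inner_smul_left]
  definite f hf := eq_zero_of_toL2_eq_zero f (inner_self_eq_zero.1 hf)

instance : NormedAddCommGroup EvenF2 := innerCore.toNormedAddCommGroup

instance : InnerProductSpace ℂ EvenF2 := InnerProductSpace.ofCore innerCore.toCore

theorem inner_eq_integral (f g : EvenF2) :
    inner ℂ f g = ∫ x : ℝ, (starRingEnd ℂ) ((x : ℂ) * f.fn x) * ((x : ℂ) * g.fn x) := by
  change inner ℂ (toL2 f) (toL2 g) = _
  rw [L2.inner_def]
  refine integral_congr_ae ?_
  filter_upwards [MemLp.coeFn_toLp f.memLp, MemLp.coeFn_toLp g.memLp] with x hx hy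
  change inner ℂ ((f.memLp.toLp (mulX f.fn) : ℝ → ℂ) x) ((g.memLp.toLp (mulX g.fn) : ℝ → ℂ) x) = _
  rw [hx, hy, RCLike.inner_apply, mul_comm]
  rfl

/-- The function `h_k(z) = 4√2 cos(πz) / (π (k² - 4z²))`. At the removable singularities
`z = ±k/2` (for odd `k`) it has its limit value `√2 sin(πk/2) / k`. -/
def hFun (k : ℕ) (z : ℂ) : ℂ :=
  if (k : ℂ) ^ 2 - 4 * z ^ 2 = 0 then
    (Real.sqrt 2 : ℂ) * Complex.sin (Real.pi * k / 2) / k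
  else
    4 * (Real.sqrt 2 : ℂ) * Complex.cos (Real.pi * z) / (Real.pi * ((k : ℂ) ^ 2 - 4 * z ^ 2))

end PaleyWienerEven

end

open MeasureTheory

noncomputable section

namespace PaleyWienerEven

open Complex Filter Set Topology
open scoped Real ContDiff FourierTransform SchwartzMap

/-! For `h` in the space, `x h` is odd, square integrable and extends to an entire function of
exponential type `π`. By Paley–Wiener it is the Fourier transform of an odd `φ ∈ L²` supported in
`[-1/2, 1/2]` (`exists_spectrum`). Conversely, the transform of such a `φ` is entire and odd, hence
vanishes at `0` and can be divided by `z` (`IsOddBandLimited.exists_toL2_eq`). By Plancherel the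
space is thus isometric to the odd functions in `L²[-1/2, 1/2]`, a closed subspace, so it is
complete.

Under this isometry `h_k` corresponds to `i √2 sin(πk/2) sin(πkt)`, where `sin(πk/2) = ±1`
(`mul_hFun_eq`). Pairing `f` with `h_j` therefore samples `x f` at `j/2` up to a nonzero factor
(`inner_hFun`). Orthonormality follows because `h_k` vanishes at the other points `j/2`. If all
samples of `f` vanish, so do all Fourier coefficients of `exp(-πit) φ` on an interval of length one,
and Parseval gives `φ = 0`; this is density.

The Paley–Wiener step is by duality (`integral_fourierLaplace_mul_eq_zero`): a transform of a test
function supported beyond the band decays fast enough in a half plane to beat the growth of the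
entire function, so Cauchy's theorem makes their pairing vanish. -/

/-! ### Fourier–Laplace transforms of functions with bounded support -/

/-- The Fourier–Laplace transform `z ↦ ∫ exp (-2πi t z) φ(t) dt`, which extends the Fourier
transform of `φ` from the real line to the complex plane. -/
def fourierLaplace (φ : ℝ → ℂ) (z : ℂ) : ℂ := ∫ t : ℝ, exp (-(2 * π * I * t * z)) * φ t

theorem norm_exp_kernel (t : ℝ) (z : ℂ) :
    ‖exp (-(2 * π * I * t * z))‖ = Real.exp (2 * π * t * z.im) := by
  rw [norm_exp]
  congr 1
  simp

theorem norm_fourierLaplace_le {φ : ℝ → ℂ} (hφ : Integrable φ) {z : ℂ} {c : ℝ}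
    (h : ∀ t, φ t ≠ 0 → 2 * π * t * z.im ≤ c) :
    ‖fourierLaplace φ z‖ ≤ Real.exp c * ∫ t, ‖φ t‖ := by
  rw [← integral_const_mul]
  refine norm_integral_le_of_norm_le (hφ.norm.const_mul _) (ae_of_all _ fun t => ?_)
  rw [norm_mul, norm_exp_kernel]
  by_cases ht : φ t = 0
  · simp [ht]
  · gcongr
    exact h t ht

theorem integrable_kernel_mul {φ : ℝ → ℂ} (hφ : Integrable φ) {b : ℝ}
    (hb : ∀ t, φ t ≠ 0 → |t| ≤ b) (z : ℂ) :
    Integrable fun t : ℝ => exp (-(2 * π * I * t * z)) * φ t := by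
  refine (hφ.norm.const_mul (Real.exp (2 * π * (b * |z.im|)))).mono'
    ((by fun_prop : Continuous fun t : ℝ => exp (-(2 * π * I * t * z))).aestronglyMeasurable.mul
      hφ.aestronglyMeasurable) (ae_of_all _ fun t => ?_)
  rw [norm_mul, norm_exp_kernel]
  by_cases ht : φ t = 0
  · simp [ht]
  · refine mul_le_mul_of_nonneg_right (Real.exp_le_exp.2 ?_) (norm_nonneg _)
    have : t * z.im ≤ b * |z.im| := by
      calc t * z.im ≤ |t * z.im| := le_abs_self _
        _ = |t| * |z.im| := abs_mul _ _
        _ ≤ b * |z.im| := by gcongr; exact hb t ht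
    have := mul_le_mul_of_nonneg_left this Real.two_pi_pos.le
    linarith

theorem hasDerivAt_fourierLaplace {φ : ℝ → ℂ} (hφ : Integrable φ) {b : ℝ}
    (hb : ∀ t, φ t ≠ 0 → |t| ≤ b) (z : ℂ) :
    HasDerivAt (fourierLaplace φ) (fourierLaplace (fun t => -(2 * π * I * t) * φ t) z) z := by
  have key := hasDerivAt_integral_of_dominated_loc_of_deriv_le (μ := volume) (x₀ := z)
    (s := Metric.ball z 1)
    (F := fun (w : ℂ) (t : ℝ) => exp (-(2 * π * I * t * w)) * φ t)
    (F' := fun (w : ℂ) (t : ℝ) => exp (-(2 * π * I * t * w)) * (-(2 * π * I * t) * φ t))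
    (bound := fun t => Real.exp (2 * π * (b * (|z.im| + 1))) * (2 * π * b) * ‖φ t‖)
    (Metric.ball_mem_nhds z one_pos)
    (Eventually.of_forall fun w => (integrable_kernel_mul hφ hb w).aestronglyMeasurable)
    (integrable_kernel_mul hφ hb z) ?_ ?_ (hφ.norm.const_mul _) ?_
  · exact key.2
  · exact ((by fun_prop : Continuous fun t : ℝ =>
      exp (-(2 * π * I * t * z))).aestronglyMeasurable).mul
      ((by fun_prop : Continuous fun t : ℝ => -(2 * π * I * (t : ℂ))).aestronglyMeasurable.mul
        hφ.aestronglyMeasurable)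
  · refine ae_of_all _ fun t w hw => ?_
    rw [norm_mul, norm_mul, norm_exp_kernel]
    by_cases ht : φ t = 0
    · simp [ht]
    · have htb := hb t ht
      have hb0 : 0 ≤ b := (abs_nonneg t).trans htb
      have hw1 : |w.im| ≤ |z.im| + 1 := by
        have h1 : |w.im - z.im| ≤ ‖w - z‖ := by simpa using abs_im_le_norm (w - z)
        have h2 : ‖w - z‖ < 1 := by simpa [dist_eq_norm] using hw
        have h3 := abs_sub_abs_le_abs_sub w.im z.im
        linarith
      have h4 : t * w.im ≤ b * (|z.im| + 1) := by
        calc t * w.im ≤ |t * w.im| := le_abs_self _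
          _ = |t| * |w.im| := abs_mul _ _
          _ ≤ _ := by gcongr
      have h5 : ‖-(2 * π * I * (t : ℂ))‖ ≤ 2 * π * b := by
        simp only [norm_neg, norm_mul, norm_ofNat, norm_real, Real.norm_eq_abs, norm_I, mul_one,
          abs_of_pos Real.pi_pos]
        gcongr
      have h6 : 2 * π * t * w.im ≤ 2 * π * (b * (|z.im| + 1)) := by
        have := mul_le_mul_of_nonneg_left h4 Real.two_pi_pos.le
        linarith
      calc _ ≤ Real.exp (2 * π * (b * (|z.im| + 1))) * (2 * π * b * ‖φ t‖) := by gcongr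
        _ = _ := by ring
  · refine ae_of_all _ fun t w _ => ?_
    have h1 : HasDerivAt (fun w : ℂ => -(2 * π * I * t * w)) (-(2 * π * I * t)) w := by
      simpa using ((hasDerivAt_id w).const_mul (2 * π * I * (t : ℂ))).fun_neg
    exact (h1.cexp.mul_const (φ t)).congr_deriv (by ring)

theorem differentiable_fourierLaplace {φ : ℝ → ℂ} (hφ : Integrable φ) {b : ℝ}
    (hb : ∀ t, φ t ≠ 0 → |t| ≤ b) : Differentiable ℂ (fourierLaplace φ) :=
  fun z => (hasDerivAt_fourierLaplace hφ hb z).differentiableAt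

/-- Integration by parts, with no boundary terms because of the compact support. It turns smoothness
of `ψ` into decay of the transform. -/
theorem fourierLaplace_deriv {ψ : ℝ → ℂ} (hψ : ContDiff ℝ 1 ψ) (hc : HasCompactSupport ψ) (z : ℂ) :
    fourierLaplace (deriv ψ) z = 2 * π * I * z * fourierLaplace ψ z := by
  have hk : Continuous fun t : ℝ => exp (-(2 * π * I * t * z)) := by fun_prop
  have hd : Continuous (deriv ψ) := hψ.continuous_deriv le_rfl
  have h1 (t : ℝ) : HasDerivAt (fun t : ℝ => exp (-(2 * π * I * t * z)))
      (exp (-(2 * π * I * t * z)) * -(2 * π * I * z)) t := by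
    have h0 : HasDerivAt (fun t : ℝ => -(2 * π * I * t * z)) (-(2 * π * I * z)) t := by
      have := (((ofRealCLM.hasDerivAt (x := t)).const_mul (2 * π * I)).mul_const z).fun_neg
      simpa using this
    exact h0.cexp
  have := integral_mul_deriv_eq_deriv_mul_of_integrable
    (u := fun t : ℝ => exp (-(2 * π * I * t * z))) (v := ψ)
    (u' := fun t : ℝ => exp (-(2 * π * I * t * z)) * -(2 * π * I * z)) (v' := deriv ψ)
    (fun t _ => h1 t) (fun t _ => (hψ.differentiable one_ne_zero t).hasDerivAt)
    ((hk.mul hd).integrable_of_hasCompactSupport hc.deriv.mul_left)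
    (((hk.mul continuous_const).mul hψ.continuous).integrable_of_hasCompactSupport hc.mul_left)
    ((hk.mul hψ.continuous).integrable_of_hasCompactSupport hc.mul_left)
  rw [fourierLaplace, this, fourierLaplace, ← integral_const_mul, ← integral_neg]
  congr 1 with t
  ring

/-! ### Contour integration and growth in the upper half plane -/

/-- If an entire function is `O(1 / (1 + |z|²))` in the closed upper half plane, then its integral
over the real line vanishes. -/
theorem integral_eq_zero_of_norm_le_upperHalfPlane {H : ℂ → ℂ} (hH : Differentiable ℂ H) {C : ℝ}
    (hC : ∀ z : ℂ, 0 ≤ z.im → ‖H z‖ ≤ C / (1 + ‖z‖ ^ 2)) : ∫ x : ℝ, H x = 0 := by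
  have hC0 : 0 ≤ C := by
    have := (norm_nonneg _).trans (hC 0 (by simp))
    simpa using this
  have hcont : Continuous fun x : ℝ => H x := hH.continuous.comp continuous_ofReal
  have hint : Integrable fun x : ℝ => H x := by
    refine (integrable_inv_one_add_sq.const_mul C).mono' hcont.aestronglyMeasurable
      (ae_of_all _ fun x => ?_)
    simpa [div_eq_mul_inv] using hC x (by simp)
  have hlim := intervalIntegral_tendsto_integral hint tendsto_neg_atTop_atBot tendsto_id
  -- Cauchy on the rectangle with corners `-R` and `R + iR`: the other three edges have total length
  -- `4R`, and on them `‖H‖ ≤ C / R²`.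
  refine tendsto_nhds_unique hlim (squeeze_zero_norm' (a := fun R : ℝ => 4 * C * R⁻¹) ?_ ?_)
  · filter_upwards [eventually_gt_atTop 0] with R hR
    have hrect := integral_boundary_rect_eq_zero_of_differentiableOn H (-R : ℂ) (R + R * I)
      hH.differentiableOn
    simp only [neg_re, ofReal_re, add_re, mul_re, I_re, mul_zero, ofReal_im, I_im, mul_one,
      sub_self, add_zero, neg_im, neg_zero, add_im, mul_im, zero_add, ofReal_zero, zero_mul,
      smul_eq_mul] at hrect
    have hden (z : ℂ) (hz : R ≤ ‖z‖) (hi : 0 ≤ z.im) : ‖H z‖ ≤ C / R ^ 2 := by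
      refine (hC z hi).trans ?_
      gcongr
      nlinarith
    have htop : ‖∫ x : ℝ in -R..R, H (x + R * I)‖ ≤ C / R ^ 2 * |R - -R| := by
      refine intervalIntegral.norm_integral_le_of_norm_le_const fun x _ => hden _ ?_ ?_
      · have := abs_im_le_norm ((x : ℂ) + R * I)
        simp only [add_im, ofReal_im, mul_im, ofReal_re, I_im, mul_one, I_re, mul_zero, add_zero,
          zero_add] at this
        exact (le_abs_self R).trans this
      · simp [hR.le]
    have hside (s : ℝ) (hs : |s| = R) :
        ‖∫ y : ℝ in (0 : ℝ)..R, H (s + y * I)‖ ≤ C / R ^ 2 * |R - 0| := by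
      refine intervalIntegral.norm_integral_le_of_norm_le_const fun y hy => hden _ ?_ ?_
      · have := abs_re_le_norm ((s : ℂ) + y * I)
        simpa [hs] using this
      · rw [uIoc_of_le hR.le] at hy
        simpa using hy.1.le
    have h1 := hside R (abs_of_pos hR)
    have h2 := hside (-R) (by rw [abs_neg, abs_of_pos hR])
    have heq : ∫ x : ℝ in -R..R, H x = (∫ x : ℝ in -R..R, H (x + R * I))
        - I * (∫ y : ℝ in (0 : ℝ)..R, H (R + y * I))
        + I * (∫ y : ℝ in (0 : ℝ)..R, H ((-R : ℝ) + y * I)) := by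
      linear_combination hrect
    have h3 : ‖∫ x : ℝ in -R..R, H x‖ ≤ C / R ^ 2 * |R - -R| + C / R ^ 2 * |R - 0|
        + C / R ^ 2 * |R - 0| := by
      rw [heq]
      refine (norm_add_le _ _).trans (add_le_add ((norm_sub_le _ _).trans (add_le_add htop ?_)) ?_)
      · simpa using h1
      · simpa using h2
    refine h3.trans (le_of_eq ?_)
    rw [sub_neg_eq_add, sub_zero, abs_of_pos hR, abs_of_pos (by linarith : 0 < R + R)]
    field_simp
    ring
  · simpa using tendsto_inv_atTop_zero.const_mul (4 * C)

/-- A Phragmén–Lindelöf bound in the upper half plane for an entire function of exponential type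
which grows at most linearly on the real line. -/
theorem exists_norm_le_upperHalfPlane {G : ℂ → ℂ} (hG : Differentiable ℂ G) {τ : ℝ} (hτ0 : 0 ≤ τ)
    (hτ : HasExpTypeAtMost G τ) {A : ℝ} (hA : ∀ x : ℝ, ‖G x‖ ≤ A * (1 + |x|)) {ε : ℝ}
    (hε : 0 < ε) :
    ∃ M : ℝ, ∀ z : ℂ, 0 ≤ z.im → ‖G z‖ ≤ M * (1 + ‖z‖) * Real.exp ((τ + ε) * z.im) := by
  obtain ⟨C, hC, hGC⟩ := hτ ε hε
  have hA0 : 0 ≤ A := by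
    have := (norm_nonneg _).trans (hA 0)
    simpa using this
  -- With `z = i w` the upper half plane becomes the right one. Dividing by `w + 1` absorbs the
  -- linear growth on the boundary, where `1 + |x| ≤ 2 ‖ix + 1‖` gives the bound `2A`; the
  -- exponential compensates the type, giving the bound `C` on the positive axis.
  set f : ℂ → ℂ := fun w => G (I * w) / (w + 1) * exp (-((τ + ε : ℝ) * w)) with hf
  have hne (w : ℂ) (hw : 0 ≤ w.re) : 1 ≤ ‖w + 1‖ := by
    have h1 := abs_re_le_norm (w + 1)
    have h2 := le_abs_self (w + 1).re
    simp only [add_re, one_re] at h1 h2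
    linarith
  have hne' (w : ℂ) (hw : 0 ≤ w.re) : w + 1 ≠ 0 := by
    intro h0
    have := hne w hw
    rw [h0, norm_zero] at this
    linarith
  have hnorm (w : ℂ) : ‖f w‖ = ‖G (I * w)‖ / ‖w + 1‖ * Real.exp (-((τ + ε) * w.re)) := by
    rw [hf, norm_mul, norm_div, norm_exp]
    simp
  have hdiff : DifferentiableOn ℂ f (closure {z : ℂ | 0 < z.re}) := by
    rw [closure_setOfPred_lt_re]
    intro w hw
    have h1 : DifferentiableAt ℂ (fun w => G (I * w)) w :=
      (hG _).comp w (differentiableAt_id.const_mul I)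
    exact ((h1.div (differentiableAt_id.add_const 1) (hne' w hw)).mul
      (by fun_prop)).differentiableWithinAt
  have hmain (w : ℂ) (hw : 0 ≤ w.re) : ‖f w‖ ≤ 2 * A + C := by
    refine PhragmenLindelof.right_half_plane_of_bounded_on_real (C := 2 * A + C)
      hdiff.diffContOnCl ⟨1, one_lt_two, τ + ε, ?_⟩ ?_ ?_ hw
    · refine Asymptotics.IsBigO.of_bound C ?_
      refine eventually_inf_principal.2 (Eventually.of_forall fun w hw => ?_)
      have hw' : 0 ≤ w.re := le_of_lt hw
      rw [hnorm, Real.rpow_one, Real.norm_of_nonneg (Real.exp_pos _).le]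
      have h1 : ‖G (I * w)‖ ≤ C * Real.exp ((τ + ε) * ‖w‖) := by simpa using hGC (I * w)
      have h2 : Real.exp (-((τ + ε) * w.re)) ≤ 1 := by
        rw [Real.exp_le_one_iff, neg_nonpos]
        positivity
      calc _ ≤ ‖G (I * w)‖ * 1 :=
            mul_le_mul (div_le_self (norm_nonneg _) (hne w hw')) h2 (Real.exp_pos _).le
              (norm_nonneg _)
        _ ≤ _ := by rwa [mul_one]
    · refine isBoundedUnder_of_eventually_le (a := C) ?_
      filter_upwards [eventually_ge_atTop 0] with x hx
      rw [hnorm]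
      have h1 : ‖G (I * x)‖ ≤ C * Real.exp ((τ + ε) * x) := by
        simpa [abs_of_nonneg hx] using hGC (I * x)
      calc _ ≤ C * Real.exp ((τ + ε) * x) * Real.exp (-((τ + ε) * (x : ℂ).re)) := by
            gcongr
            exact (div_le_self (norm_nonneg _) (hne x (by simpa using hx))).trans h1
        _ = C := by rw [ofReal_re, mul_assoc, ← Real.exp_add]; simp
    · intro x
      rw [hnorm]
      have h1 : I * (x * I) = ((-x : ℝ) : ℂ) := by
        push_cast
        linear_combination (x : ℂ) * I_mul_I
      have h2 : (1 + |x|) / 2 ≤ ‖(x * I + 1 : ℂ)‖ := by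
        have h3 := abs_im_le_norm (x * I + 1 : ℂ)
        have h4 := hne (x * I) (by simp)
        simp only [add_im, mul_im, ofReal_re, I_im, mul_one, ofReal_im, I_re, mul_zero, add_zero,
          one_im] at h3
        linarith
      have h3 : ‖G (I * (x * I))‖ ≤ A * (1 + |x|) := by
        rw [h1]
        simpa using hA (-x)
      have h5 : 0 < 1 + |x| := by positivity
      have h4 : ‖G (I * (x * I))‖ / ‖(x * I + 1 : ℂ)‖ ≤ 2 * A := by
        rw [div_le_iff₀ (by linarith)]
        nlinarith
      simp only [mul_re, ofReal_re, I_re, mul_zero, ofReal_im, I_im, mul_one, sub_self, neg_zero,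
        Real.exp_zero]
      linarith
  refine ⟨2 * A + C, fun z hz => ?_⟩
  have h1 := hmain (-I * z) (by simpa using hz)
  have h2 : I * (-I * z) = z := by linear_combination -z * I_mul_I
  have h3 : 0 < ‖-I * z + 1‖ := one_pos.trans_le (hne _ (by simpa using hz))
  have h4 : (-I * z).re = z.im := by simp
  rw [hnorm, h2, h4, Real.exp_neg, ← div_eq_mul_inv, div_le_iff₀ (Real.exp_pos _),
    div_le_iff₀ h3] at h1
  have h5 : ‖-I * z + 1‖ ≤ 1 + ‖z‖ := by
    refine (norm_add_le _ _).trans ?_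
    simp [add_comm]
  calc ‖G z‖ ≤ (2 * A + C) * Real.exp ((τ + ε) * z.im) * ‖-I * z + 1‖ := h1
    _ ≤ (2 * A + C) * Real.exp ((τ + ε) * z.im) * (1 + ‖z‖) := by gcongr
    _ = _ := by ring

/-- Each power of `z` is traded for a derivative of `ψ`, which keeps the support in `(-∞, -a]`;
there the kernel is at most `exp(-2πa Im z)`. -/
theorem exists_pow_mul_norm_fourierLaplace_le (n : ℕ) {ψ : ℝ → ℂ} (hψ : ContDiff ℝ ∞ ψ)
    (hc : HasCompactSupport ψ) {a : ℝ} (ha : tsupport ψ ⊆ Iic (-a)) :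
    ∃ C : ℝ, ∀ z : ℂ, 0 ≤ z.im →
      ‖z‖ ^ n * ‖fourierLaplace ψ z‖ ≤ C * Real.exp (-(2 * π * a * z.im)) := by
  induction n generalizing ψ with
  | zero =>
    refine ⟨∫ t, ‖ψ t‖, fun z hz => ?_⟩
    rw [pow_zero, one_mul, mul_comm]
    refine norm_fourierLaplace_le (hψ.continuous.integrable_of_hasCompactSupport hc) fun t ht => ?_
    have h1 : t ≤ -a := ha (subset_tsupport _ ht)
    have := mul_le_mul_of_nonneg_left h1 (mul_nonneg Real.two_pi_pos.le hz)
    linarith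
  | succ n ih =>
    obtain ⟨C, hC⟩ := ih (ψ := deriv ψ) (hψ.iterate_deriv 1) hc.deriv
      ((closure_minimal support_deriv_subset (isClosed_tsupport _)).trans ha)
    refine ⟨C / (2 * π), fun z hz => ?_⟩
    have h1 := hC z hz
    rw [fourierLaplace_deriv (hψ.of_le (by simp)) hc] at h1
    simp only [norm_mul, norm_ofNat, norm_real, Real.norm_eq_abs, abs_of_pos Real.pi_pos, norm_I,
      mul_one] at h1
    rw [div_mul_eq_mul_div, le_div_iff₀ Real.two_pi_pos]
    calc _ = ‖z‖ ^ n * (2 * π * ‖z‖ * ‖fourierLaplace ψ z‖) := by ring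
      _ ≤ _ := h1

/-- Of the three powers, one pays for the linear growth of the primitive of `g`; the other two make
the product integrable. -/
theorem exists_norm_fourierLaplace_le {ψ : ℝ → ℂ} (hψ : ContDiff ℝ ∞ ψ)
    (hc : HasCompactSupport ψ) {a : ℝ} (ha : tsupport ψ ⊆ Iic (-a)) :
    ∃ C : ℝ, 0 ≤ C ∧ ∀ z : ℂ, 0 ≤ z.im →
      ‖fourierLaplace ψ z‖ ≤ C * Real.exp (-(2 * π * a * z.im)) / (1 + ‖z‖) ^ 3 := by
  obtain ⟨C, hC⟩ := exists_pow_mul_norm_fourierLaplace_le 0 hψ hc ha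
  obtain ⟨D, hD⟩ := exists_pow_mul_norm_fourierLaplace_le 3 hψ hc ha
  refine ⟨|4 * (C + D)|, abs_nonneg _, fun z hz => ?_⟩
  have h1 := hC z hz
  have h2 := hD z hz
  rw [le_div_iff₀ (by positivity)]
  have h3 : (1 + ‖z‖) ^ 3 ≤ 4 * (‖z‖ ^ 0 + ‖z‖ ^ 3) := by
    nlinarith [norm_nonneg z, mul_nonneg (norm_nonneg z) (sq_nonneg (‖z‖ - 1)),
      sq_nonneg (‖z‖ - 1)]
  calc ‖fourierLaplace ψ z‖ * (1 + ‖z‖) ^ 3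
      ≤ ‖fourierLaplace ψ z‖ * (4 * (‖z‖ ^ 0 + ‖z‖ ^ 3)) := by gcongr
    _ ≤ 4 * (C + D) * Real.exp (-(2 * π * a * z.im)) := by linarith
    _ ≤ _ := by gcongr; exact le_abs_self _

/-- Phragmén–Lindelöf needs a pointwise bound on the real line, which `L²` membership does not
directly provide for `g`. A primitive has one, because `‖g‖ ≤ 1 + ‖g‖²`. -/
theorem exists_primitive {g : ℂ → ℂ} (hg : Differentiable ℂ g) {τ : ℝ} (hτ0 : 0 ≤ τ)
    (hτ : HasExpTypeAtMost g τ) (hL2 : MemLp (fun x : ℝ => g x) 2) :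
    ∃ G : ℂ → ℂ, (∀ z, HasDerivAt G (g z) z) ∧ HasExpTypeAtMost G τ ∧
      ∃ A : ℝ, ∀ x : ℝ, ‖G x‖ ≤ A * (1 + |x|) := by
  obtain ⟨G₀, hG₀⟩ := hg.isExactOn_univ
  have hG (z : ℂ) : HasDerivAt (fun z => G₀ z - G₀ 0) (g z) z := (hG₀ z (mem_univ z)).sub_const _
  refine ⟨fun z => G₀ z - G₀ 0, hG, fun ε hε => ?_, ?_⟩
  -- Half of `ε` is kept to absorb the factor `‖z‖` coming from the mean value inequality.
  · obtain ⟨C, hC, hgC⟩ := hτ (ε / 2) (by positivity)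
    refine ⟨C * (2 / ε), by positivity, fun z => ?_⟩
    have h1 := (convex_closedBall (0 : ℂ) ‖z‖).norm_image_sub_le_of_norm_hasDerivWithin_le
      (f := fun z => G₀ z - G₀ 0) (f' := g) (C := C * Real.exp ((τ + ε / 2) * ‖z‖)) (x := 0) (y := z)
      (fun w _ => (hG w).hasDerivWithinAt) (fun w hw => (hgC w).trans ?_) (by simp) (by simp)
    · simp only [sub_self, sub_zero] at h1
      refine h1.trans ?_
      have h2 : ‖z‖ ≤ 2 / ε * Real.exp (ε / 2 * ‖z‖) := by
        have := Real.add_one_le_exp (ε / 2 * ‖z‖)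
        rw [div_mul_eq_mul_div, le_div_iff₀ hε]
        linarith
      calc C * Real.exp ((τ + ε / 2) * ‖z‖) * ‖z‖
          ≤ C * Real.exp ((τ + ε / 2) * ‖z‖) * (2 / ε * Real.exp (ε / 2 * ‖z‖)) := by gcongr
        _ = C * (2 / ε) * (Real.exp ((τ + ε / 2) * ‖z‖) * Real.exp (ε / 2 * ‖z‖)) := by ring
        _ = _ := by rw [← Real.exp_add]; ring_nf
    · have : ‖w‖ ≤ ‖z‖ := by simpa using hw
      gcongr
  · have hcont : Continuous fun x : ℝ => g x := hg.continuous.comp continuous_ofReal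
    have hsq : Integrable fun x : ℝ => ‖g x‖ ^ 2 :=
      (memLp_two_iff_integrable_sq_norm hcont.aestronglyMeasurable).1 hL2
    have hS : 0 ≤ ∫ x : ℝ, ‖g x‖ ^ 2 := integral_nonneg fun x => by positivity
    refine ⟨1 + ∫ x : ℝ, ‖g x‖ ^ 2, fun x => ?_⟩
    have hfin : volume (uIoc 0 x) ≠ ⊤ := by simp [uIoc]
    have h1 : G₀ x - G₀ 0 = ∫ t in (0 : ℝ)..x, g t := by
      rw [intervalIntegral.integral_eq_sub_of_hasDerivAt (f := fun t : ℝ => G₀ t)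
        (fun t _ => (hG₀ t (mem_univ _)).comp_ofReal) (hcont.intervalIntegrable _ _)]
      simp
    change ‖G₀ x - G₀ 0‖ ≤ _
    rw [h1]
    have hi : IntegrableOn (fun _ : ℝ => (1 : ℝ)) (uIoc 0 x) := integrableOn_const hfin
    calc ‖∫ t in (0 : ℝ)..x, g t‖ ≤ ∫ t in uIoc 0 x, ‖g t‖ :=
          intervalIntegral.norm_integral_le_integral_norm_uIoc
      _ ≤ ∫ t in uIoc 0 x, (1 + ‖g t‖ ^ 2) := by
          refine integral_mono ((hcont.norm.intervalIntegrable 0 x).def') (hi.add hsq.integrableOn)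
            fun t => ?_
          change ‖g t‖ ≤ 1 + ‖g t‖ ^ 2
          nlinarith [sq_nonneg (‖g t‖ - 1)]
      _ = |x| + ∫ t in uIoc 0 x, ‖g t‖ ^ 2 := by
          rw [integral_add hi hsq.integrableOn]
          simp [uIoc, Measure.real, max_sub_min_eq_abs]
      _ ≤ |x| + ∫ t : ℝ, ‖g t‖ ^ 2 := by
          refine add_le_add_right (setIntegral_le_integral hsq (ae_of_all _ fun t => ?_)) _
          exact sq_nonneg ‖g t‖
      _ ≤ _ := by nlinarith [abs_nonneg x]

/-- The core of the Paley–Wiener theorem: an entire function of exponential type `2πb` in `L²(ℝ)`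
is orthogonal to the Fourier transforms of test functions supported in `(-∞, -b)`. -/
theorem integral_fourierLaplace_mul_eq_zero {g : ℂ → ℂ} (hg : Differentiable ℂ g) {b : ℝ}
    (hb : 0 ≤ b) (hτ : HasExpTypeAtMost g (2 * π * b)) (hL2 : MemLp (fun x : ℝ => g x) 2)
    {ψ : ℝ → ℂ} (hψ : ContDiff ℝ ∞ ψ) (hc : HasCompactSupport ψ) (hs : tsupport ψ ⊆ Iio (-b)) :
    ∫ x : ℝ, fourierLaplace ψ x * g x = 0 := by
  -- Compactness of the support leaves a gap `a - b > 0`. It is spent below as the `ε` of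
  -- Phragmén–Lindelöf, so that the exponentials cancel exactly.
  obtain ⟨a, hab, ha⟩ : ∃ a, b < a ∧ tsupport ψ ⊆ Iic (-a) := by
    rcases (tsupport ψ).eq_empty_or_nonempty with h | h
    · exact ⟨b + 1, by linarith, by simp [h]⟩
    · obtain ⟨m, hm, hmax⟩ := hc.isCompact.exists_isGreatest h
      exact ⟨-m, by have := hs hm; simp only [mem_Iio] at this; linarith,
        fun t ht => by simpa using hmax ht⟩
  obtain ⟨r, hr⟩ : ∃ r, ∀ t ∈ tsupport ψ, |t| ≤ r := by
    obtain ⟨r, hr⟩ := hc.isCompact.isBounded.exists_norm_le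
    exact ⟨r, fun t ht => by simpa using hr t ht⟩
  obtain ⟨G, hG, hGτ, A, hA⟩ := exists_primitive hg (by positivity) hτ hL2
  have hGd : Differentiable ℂ G := fun z => (hG z).differentiableAt
  obtain ⟨M, hM⟩ := exists_norm_le_upperHalfPlane hGd (by positivity) hGτ hA
    (ε := 2 * π * (a - b)) (mul_pos Real.two_pi_pos (by linarith))
  -- The transform of `χ` is the derivative of the transform of `ψ`; the integration by parts below
  -- moves the derivative from `G` onto it.
  set χ : ℝ → ℂ := fun t => -(2 * π * I * t) * ψ t with hχ
  have hχs : ContDiff ℝ ∞ χ := by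
    have : ContDiff ℝ ∞ (fun t : ℝ => (t : ℂ)) := ofRealCLM.contDiff
    fun_prop
  have hχc : HasCompactSupport χ := hc.mul_left
  have hχt : tsupport χ ⊆ tsupport ψ := tsupport_mul_subset_right
  have hψi : Integrable ψ := hψ.continuous.integrable_of_hasCompactSupport hc
  have hχi : Integrable χ := hχs.continuous.integrable_of_hasCompactSupport hχc
  have hψr (t : ℝ) (ht : ψ t ≠ 0) : |t| ≤ r := hr t (subset_tsupport _ ht)
  have hχr (t : ℝ) (ht : χ t ≠ 0) : |t| ≤ r := hr t (hχt (subset_tsupport _ ht))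
  obtain ⟨C, hC0, hC⟩ := exists_norm_fourierLaplace_le hψ hc ha
  obtain ⟨D, hD0, hD⟩ := exists_norm_fourierLaplace_le hχs hχc (hχt.trans ha)
  have hprod {K : ℝ} (hK : 0 ≤ K) {φ : ℝ → ℂ} (h : ∀ z : ℂ, 0 ≤ z.im →
      ‖fourierLaplace φ z‖ ≤ K * Real.exp (-(2 * π * a * z.im)) / (1 + ‖z‖) ^ 3)
      (z : ℂ) (hz : 0 ≤ z.im) : ‖fourierLaplace φ z * G z‖ ≤ |K * M| / (1 + ‖z‖ ^ 2) := by
    have h1 : 0 < 1 + ‖z‖ := by positivity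
    rw [norm_mul]
    calc _ ≤ K * Real.exp (-(2 * π * a * z.im)) / (1 + ‖z‖) ^ 3 *
          (M * (1 + ‖z‖) * Real.exp ((2 * π * b + 2 * π * (a - b)) * z.im)) :=
          mul_le_mul (h z hz) (hM z hz) (norm_nonneg _) (by positivity)
      _ = K * M * (Real.exp (-(2 * π * a * z.im)) *
          Real.exp ((2 * π * b + 2 * π * (a - b)) * z.im)) / (1 + ‖z‖) ^ 2 := by
          field_simp
      _ = K * M / (1 + ‖z‖) ^ 2 := by
          rw [← Real.exp_add]
          ring_nf
          simp
      _ ≤ |K * M| / (1 + ‖z‖ ^ 2) := by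
          gcongr
          · exact le_abs_self _
          · nlinarith [norm_nonneg z]
  have hGc : Continuous fun x : ℝ => G x := hGd.continuous.comp continuous_ofReal
  have hgc : Continuous fun x : ℝ => g x := hg.continuous.comp continuous_ofReal
  have hLc {φ : ℝ → ℂ} (hi : Integrable φ) (h : ∀ t, φ t ≠ 0 → |t| ≤ r) :
      Continuous fun x : ℝ => fourierLaplace φ x :=
    (differentiable_fourierLaplace hi h).continuous.comp continuous_ofReal
  have hint {K : ℝ} (hK : 0 ≤ K) {φ : ℝ → ℂ} (h : ∀ z : ℂ, 0 ≤ z.im →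
      ‖fourierLaplace φ z‖ ≤ K * Real.exp (-(2 * π * a * z.im)) / (1 + ‖z‖) ^ 3)
      (hc : Continuous fun x : ℝ => fourierLaplace φ x) :
      Integrable fun x : ℝ => fourierLaplace φ x * G x := by
    refine (integrable_inv_one_add_sq.const_mul |K * M|).mono'
      (hc.mul hGc).aestronglyMeasurable (ae_of_all _ fun x => ?_)
    simpa [div_eq_mul_inv] using hprod hK h x (by simp)
  have hψg : Integrable fun x : ℝ => fourierLaplace ψ x * g x := by
    have hsq : Integrable fun x : ℝ => ‖g x‖ ^ 2 :=
      (memLp_two_iff_integrable_sq_norm hgc.aestronglyMeasurable).1 hL2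
    refine ((integrable_inv_one_add_sq.const_mul (C ^ 2)).add hsq).mono'
      ((hLc hψi hψr).mul hgc).aestronglyMeasurable (ae_of_all _ fun x => ?_)
    have h1 : ‖fourierLaplace ψ x‖ ≤ C / (1 + |x|) ^ 3 := by simpa using hC x (by simp)
    have h2 : (C / (1 + |x|) ^ 3) ^ 2 ≤ C ^ 2 * (1 + x ^ 2)⁻¹ := by
      rw [div_pow, div_eq_mul_inv]
      gcongr
      have h3 : 1 ≤ 1 + |x| := by linarith [abs_nonneg x]
      calc 1 + x ^ 2 ≤ (1 + |x|) ^ 2 := by nlinarith [abs_nonneg x, sq_abs x]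
        _ ≤ (1 + |x|) ^ 6 := pow_le_pow_right₀ h3 (by norm_num)
        _ = _ := by ring
    have h4 : ‖fourierLaplace ψ x‖ ^ 2 ≤ (C / (1 + |x|) ^ 3) ^ 2 := by gcongr
    rw [norm_mul]
    change _ ≤ C ^ 2 * (1 + x ^ 2)⁻¹ + ‖g x‖ ^ 2
    nlinarith [sq_nonneg (‖fourierLaplace ψ x‖ - ‖g x‖), norm_nonneg (g x),
      norm_nonneg (fourierLaplace ψ x)]
  have hparts := integral_mul_deriv_eq_deriv_mul_of_integrable
    (u := fun x : ℝ => fourierLaplace ψ x) (v := fun x : ℝ => G x)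
    (u' := fun x : ℝ => fourierLaplace χ x) (v' := fun x : ℝ => g x)
    (fun x _ => (hasDerivAt_fourierLaplace hψi hψr x).comp_ofReal)
    (fun x _ => (hG x).comp_ofReal) hψg
    (hint hD0 hD (hLc hχi hχr)) (hint hC0 hC (hLc hψi hψr))
  rw [hparts, integral_eq_zero_of_norm_le_upperHalfPlane
    (H := fun z => fourierLaplace χ z * G z)
    ((differentiable_fourierLaplace hχi hχr).mul hGd) (hprod hD0 hD), neg_zero]

/-! ### The `L²` Fourier transform tested against smooth functions -/

theorem fourierLaplace_ofReal (φ : ℝ → ℂ) (x : ℝ) : fourierLaplace φ x = 𝓕 φ x := by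
  rw [Real.fourier_real_eq_integral_exp_smul, fourierLaplace]
  congr 1 with t
  rw [smul_eq_mul]
  congr 2
  push_cast
  ring

theorem fourierLaplace_neg_ofReal (φ : ℝ → ℂ) (x : ℝ) :
    fourierLaplace φ (-(x : ℂ)) = 𝓕⁻ φ x := by
  rw [Real.fourierInv_eq_fourier_neg, ← fourierLaplace_ofReal, ofReal_neg]

theorem fourierLaplace_comp_neg (φ : ℝ → ℂ) (z : ℂ) :
    fourierLaplace (fun t => φ (-t)) z = fourierLaplace φ (-z) := by
  rw [fourierLaplace, fourierLaplace, ← integral_neg_eq_self]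
  congr 1 with t
  simp

theorem fourierLaplace_congr_ae {φ ψ : ℝ → ℂ} (h : φ =ᵐ[volume] ψ) :
    fourierLaplace φ = fourierLaplace ψ := by
  ext z
  refine integral_congr_ae ?_
  filter_upwards [h] with t ht
  rw [ht]

theorem fourierLaplace_neg (φ : ℝ → ℂ) (z : ℂ) :
    fourierLaplace (fun t => -φ t) z = -fourierLaplace φ z := by
  simp [fourierLaplace, integral_neg]

theorem fourierLaplace_neg_of_odd {φ : ℝ → ℂ} (h : ∀ᵐ t, φ (-t) = -φ t) (z : ℂ) :
    fourierLaplace φ (-z) = -fourierLaplace φ z := by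
  rw [← fourierLaplace_comp_neg, fourierLaplace_congr_ae h, fourierLaplace_neg]

/-- The `L²` transform agrees with the distributional one, so almost everywhere statements about
spectra can be checked on test functions. -/
theorem integral_mul_fourierInv_toLp (f : Lp ℂ 2 (volume : Measure ℝ)) (ψ : 𝓢(ℝ, ℂ)) :
    ∫ t : ℝ, ψ t * (𝓕⁻ f : Lp ℂ 2 (volume : Measure ℝ)) t =
      ∫ x : ℝ, fourierLaplace ψ (-(x : ℂ)) * f x := by
  have h := DFunLike.congr_fun (Lp.fourierInv_toTemperedDistribution_eq f) ψ
  rw [TemperedDistribution.fourierInv_apply, Lp.toTemperedDistribution_apply,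
    Lp.toTemperedDistribution_apply, SchwartzMap.fourierInv_coe] at h
  simp_rw [fourierLaplace_neg_ofReal]
  exact h.symm

theorem integral_mul_fourier_toLp (f : Lp ℂ 2 (volume : Measure ℝ)) (ψ : 𝓢(ℝ, ℂ)) :
    ∫ x : ℝ, ψ x * (𝓕 f : Lp ℂ 2 (volume : Measure ℝ)) x = ∫ t : ℝ, 𝓕 (ψ : ℝ → ℂ) t * f t := by
  have h := DFunLike.congr_fun (Lp.fourier_toTemperedDistribution_eq f) ψ
  rw [TemperedDistribution.fourier_apply, Lp.toTemperedDistribution_apply,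
    Lp.toTemperedDistribution_apply, SchwartzMap.fourier_coe] at h
  exact h.symm

/-- A real test function as a complex Schwartz function. -/
def testFunction (ψ : ℝ → ℝ) (hψ : ContDiff ℝ ∞ ψ) (hc : HasCompactSupport ψ) : 𝓢(ℝ, ℂ) :=
  HasCompactSupport.toSchwartzMap (f := fun t => (ψ t : ℂ)) (hc.comp_left (g := ofReal) ofReal_zero)
    (ofRealCLM.contDiff.comp hψ)

theorem testFunction_apply (ψ : ℝ → ℝ) (hψ : ContDiff ℝ ∞ ψ) (hc : HasCompactSupport ψ) (t : ℝ) :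
    testFunction ψ hψ hc t = ψ t := rfl

theorem Lp.locallyIntegrable_two (f : Lp ℂ 2 (volume : Measure ℝ)) : LocallyIntegrable f :=
  (Lp.memLp f).locallyIntegrable one_le_two

/-- **Paley–Wiener**: the spectrum of an entire function of exponential type `2πb` in `L²(ℝ)` does
not meet `(-∞, -b)`. -/
theorem fourierInv_eq_zero_of_lt {g : ℂ → ℂ} (hg : Differentiable ℂ g) {b : ℝ} (hb : 0 ≤ b)
    (hτ : HasExpTypeAtMost g (2 * π * b)) (hL2 : MemLp (fun x : ℝ => g x) 2) :
    ∀ᵐ t : ℝ, t ∈ Iio (-b) → (𝓕⁻ (hL2.toLp _) : Lp ℂ 2 (volume : Measure ℝ)) t = 0 := by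
  refine isOpen_Iio.ae_eq_zero_of_integral_contDiff_smul_eq_zero
    ((Lp.locallyIntegrable_two _).locallyIntegrableOn _) fun ψ hψ hc hs => ?_
  have h1 := integral_mul_fourierInv_toLp (hL2.toLp _) (testFunction ψ hψ hc)
  simp only [testFunction_apply] at h1
  simp only [real_smul]
  have hneg : MemLp (fun x : ℝ => g (-(x : ℂ))) 2 := by
    have := hL2.comp_measurePreserving (Measure.measurePreserving_neg (volume : Measure ℝ))
    simpa [Function.comp_def] using this
  -- The pairing with the inverse transform evaluates at `-x`, hence the reflected function `g(-z)`.
  have h2 := integral_fourierLaplace_mul_eq_zero (g := fun z => g (-z)) (ψ := fun t => (ψ t : ℂ))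
    (hg.comp differentiable_neg) hb (fun ε hε => ?_) hneg
    (ofRealCLM.contDiff.comp hψ) (hc.comp_left (g := ofReal) ofReal_zero)
    ((closure_mono (Function.support_comp_subset ofReal_zero ψ)).trans hs)
  · rw [h1, ← h2, ← integral_neg_eq_self]
    refine integral_congr_ae ?_
    have h3 := (Measure.measurePreserving_neg (volume : Measure ℝ)).quasiMeasurePreserving.ae
      hL2.coeFn_toLp
    filter_upwards [h3] with x hx
    rw [hx, ofReal_neg, neg_neg]
    rfl
  · obtain ⟨C, hC, h⟩ := hτ ε hε
    exact ⟨C, hC, fun z => by simpa using h (-z)⟩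

theorem fourierInv_odd {u : Lp ℂ 2 (volume : Measure ℝ)} (hu : ∀ᵐ x : ℝ, u (-x) = -u x) :
    ∀ᵐ t : ℝ, (𝓕⁻ u : Lp ℂ 2 (volume : Measure ℝ)) (-t) =
      -(𝓕⁻ u : Lp ℂ 2 (volume : Measure ℝ)) t := by
  set φ : Lp ℂ 2 (volume : Measure ℝ) := 𝓕⁻ u with hφ
  have hneg : MemLp (fun x : ℝ => φ (-x)) 2 :=
    (Lp.memLp φ).comp_measurePreserving (Measure.measurePreserving_neg (volume : Measure ℝ))
  refine ae_eq_of_integral_contDiff_smul_eq (hneg.locallyIntegrable one_le_two)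
    (Lp.locallyIntegrable_two φ).neg fun ψ hψ hc => ?_
  have h1 := integral_mul_fourierInv_toLp u (testFunction ψ hψ hc)
  have h2 := integral_mul_fourierInv_toLp u (testFunction (fun t => ψ (-t))
    (hψ.comp contDiff_neg) (hc.comp_homeomorph (Homeomorph.neg ℝ)))
  simp only [testFunction_apply] at h1 h2
  simp only [real_smul]
  calc ∫ t : ℝ, (ψ t : ℂ) * φ (-t) = ∫ t : ℝ, (ψ (-t) : ℂ) * φ t := by
        rw [← integral_neg_eq_self]; simp
    _ = ∫ x : ℝ, fourierLaplace (testFunction ψ hψ hc) (x : ℂ) * u x := by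
        refine h2.trans ?_
        congr 1 with x
        congr 1
        rw [← fourierLaplace_comp_neg]
        congr 1 with t
        exact congrArg (fun s => (ψ s : ℂ)) (neg_neg t)
    _ = ∫ x : ℝ, fourierLaplace (testFunction ψ hψ hc) (-x : ℂ) * u (-x) := by
        rw [← integral_neg_eq_self]; simp
    _ = -∫ x : ℝ, fourierLaplace (testFunction ψ hψ hc) (-x : ℂ) * u x := by
        rw [← integral_neg]
        refine integral_congr_ae ?_
        filter_upwards [hu] with x hx
        rw [hx, mul_neg]
    _ = ∫ t : ℝ, (ψ t : ℂ) * -φ t := by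
        simp only [mul_neg, integral_neg]
        exact congrArg _ h1.symm

/-- On `L¹ ∩ L²`, with bounded spectrum, the `L²` Fourier transform is given by the integral. -/
theorem fourier_toLp_ae_eq {φ : ℝ → ℂ} (hφ : MemLp φ 2) (hi : Integrable φ) {b : ℝ}
    (hb : ∀ t, φ t ≠ 0 → |t| ≤ b) :
    (𝓕 (hφ.toLp φ) : Lp ℂ 2 (volume : Measure ℝ)) =ᵐ[volume] fun x : ℝ => fourierLaplace φ x := by
  have hcont : Continuous fun x : ℝ => fourierLaplace φ x :=
    (differentiable_fourierLaplace hi hb).continuous.comp continuous_ofReal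
  refine ae_eq_of_integral_contDiff_smul_eq (Lp.locallyIntegrable_two _)
    hcont.locallyIntegrable fun ψ hψ hc => ?_
  have h1 := integral_mul_fourier_toLp (hφ.toLp φ) (testFunction ψ hψ hc)
  simp only [testFunction_apply] at h1
  simp only [real_smul, h1, fourierLaplace_ofReal]
  -- Both functions are integrable, so Fubini moves the transform from `ψ` to `φ`.
  have h2 := VectorFourier.integral_fourierIntegral_smul_eq_flip (L := innerₗ ℝ)
    (μ := (volume : Measure ℝ)) (ν := (volume : Measure ℝ))
    Real.continuous_fourierChar continuous_inner (testFunction ψ hψ hc).integrable hi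
  rw [flip_innerₗ] at h2
  refine Eq.trans (integral_congr_ae ?_) h2
  filter_upwards [hφ.coeFn_toLp] with t ht
  rw [ht]
  rfl

theorem integrable_of_bounded_support {φ : ℝ → ℂ} (hφ : MemLp φ 2) {b : ℝ}
    (hb : ∀ t, φ t ≠ 0 → |t| ≤ b) : Integrable φ := by
  refine (integrableOn_iff_integrable_of_support_subset (s := Icc (-b) b) fun t ht => ?_).1
    ((hφ.locallyIntegrable one_le_two).integrableOn_isCompact isCompact_Icc)
  exact abs_le.1 (hb t ht)

theorem fourierLaplace_eq_intervalIntegral {φ : ℝ → ℂ} {b : ℝ} (hb0 : 0 ≤ b)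
    (hb : ∀ t, φ t ≠ 0 → |t| ≤ b) (z : ℂ) :
    fourierLaplace φ z = ∫ t in -b..b, exp (-(2 * π * I * t * z)) * φ t := by
  rw [intervalIntegral.integral_of_le (by linarith), ← integral_Icc_eq_integral_Ioc,
    setIntegral_eq_integral_of_forall_compl_eq_zero, fourierLaplace]
  intro t ht
  by_contra h
  exact ht (abs_le.1 (hb t (right_ne_zero_of_mul h)))

/-! ### Uniqueness from half-integer samples -/

/-- A square integrable function on `[-1/2, 1/2]` is determined by the values of its
Fourier–Laplace transform at the half-integers. -/
theorem ae_eq_zero_of_fourierLaplace_half {φ : ℝ → ℂ} (hφ : MemLp φ 2)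
    (hb : ∀ t, φ t ≠ 0 → |t| ≤ 1 / 2)
    (h0 : ∀ n : ℤ, fourierLaplace φ (n + 1 / 2) = 0) : φ =ᵐ[volume] 0 := by
  have hlt : (-(1 / 2) : ℝ) < 1 / 2 := by norm_num
  -- The modulation shifts frequencies by `1/2`: the value at `n + 1/2` becomes the `n`-th Fourier
  -- coefficient of `F` on an interval of length one, and Parseval applies.
  set F : ℝ → ℂ := fun t => exp (-(π * I * t)) * φ t with hF
  have hnorm (t : ℝ) : ‖F t‖ = ‖φ t‖ := by
    rw [hF, norm_mul, norm_exp]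
    simp
  have hFm : MemLp F 2 := by
    refine (memLp_congr_norm ?_ hφ.aestronglyMeasurable (ae_of_all _ hnorm)).2 hφ
    exact (by fun_prop : Continuous fun t : ℝ => exp (-(π * I * t))).aestronglyMeasurable.mul
      hφ.aestronglyMeasurable
  have hcoef (n : ℤ) : fourierCoeffOn hlt F n = 0 := by
    rw [fourierCoeffOn_eq_integral]
    have h1 := h0 n
    rw [fourierLaplace_eq_intervalIntegral (by norm_num) hb] at h1
    convert smul_zero _
    rw [← h1]
    congr 1 with t
    rw [fourier_coe_apply, smul_eq_mul, hF, ← mul_assoc, ← exp_add]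
    congr 2
    push_cast
    ring
  have hsum := hasSum_sq_fourierCoeffOn hlt (hFm.restrict _)
  simp only [hcoef, norm_zero, ne_eq, OfNat.ofNat_ne_zero, not_false_eq_true, zero_pow] at hsum
  have h2 := hsum.unique hasSum_zero
  have h3 : ∫ t : ℝ, ‖φ t‖ ^ 2 = 0 := by
    have h4 : ∫ t in (-(1 / 2) : ℝ)..1 / 2, ‖F t‖ ^ 2 = 0 := by
      refine (smul_eq_zero.1 h2).resolve_left (by norm_num)
    simp only [hnorm] at h4
    rw [← h4, intervalIntegral.integral_of_le hlt.le, ← integral_Icc_eq_integral_Ioc,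
      setIntegral_eq_integral_of_forall_compl_eq_zero]
    intro t ht
    by_contra h
    exact ht (abs_le.1 (hb t fun h5 => h (by simp [h5])))
  have h5 := (integral_eq_zero_iff_of_nonneg (fun t => sq_nonneg ‖φ t‖)
    ((memLp_two_iff_integrable_sq_norm hφ.aestronglyMeasurable).1 hφ)).1 h3
  filter_upwards [h5] with t ht
  simpa using ht

/-! ### Elements of the space and their odd spectra -/

/-- An entire function `h` such that `z h(z)` is the Fourier–Laplace transform of an odd square
integrable function supported in `[-1/2, 1/2]` belongs to `evenF2`. -/
theorem mem_evenF2_of_mul_eq {φ : ℝ → ℂ} (hφ : MemLp φ 2) (hb : ∀ t, φ t ≠ 0 → |t| ≤ 1 / 2)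
    (hodd : ∀ᵐ t, φ (-t) = -φ t) {h : ℂ → ℂ} (hd : Differentiable ℂ h)
    (hh : ∀ z, z * h z = fourierLaplace φ z) : h ∈ evenF2 := by
  have hi : Integrable φ := integrable_of_bounded_support hφ hb
  have heven (z : ℂ) : h (-z) = h z := by
    by_cases hz : z = 0
    · simp [hz]
    · have h1 := hh (-z)
      rw [fourierLaplace_neg_of_odd hodd, ← hh z, neg_mul, neg_inj] at h1
      exact mul_left_cancel₀ hz h1
  refine ⟨⟨hd, fun ε hε => ?_, ?_, fun x => by rw [heven]⟩, heven⟩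
  -- Division by `z` costs nothing for `‖z‖ ≥ 1`; compactness bounds `h` on the unit disc.
  · obtain ⟨K, hK⟩ := (isCompact_closedBall (0 : ℂ) 1).exists_bound_of_continuousOn
      hd.continuous.continuousOn
    have hK0 : 0 ≤ K := (norm_nonneg _).trans (hK 0 (by simp))
    have hI : 0 ≤ ∫ t, ‖φ t‖ := integral_nonneg fun t => norm_nonneg _
    refine ⟨K + (∫ t, ‖φ t‖) + 1, by positivity, fun z => ?_⟩
    have hexp : 1 ≤ Real.exp ((π + ε) * ‖z‖) := Real.one_le_exp (by positivity)
    rcases le_total ‖z‖ 1 with hz | hz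
    · have h1 := hK z (by simpa using hz)
      nlinarith
    · have h1 : ‖fourierLaplace φ z‖ ≤ Real.exp ((π + ε) * ‖z‖) * ∫ t, ‖φ t‖ := by
        refine norm_fourierLaplace_le hi fun t ht => ?_
        have h2 : t * z.im ≤ 1 / 2 * ‖z‖ :=
          calc t * z.im ≤ |t * z.im| := le_abs_self _
            _ = |t| * |z.im| := abs_mul _ _
            _ ≤ 1 / 2 * ‖z‖ := mul_le_mul (hb t ht) (abs_im_le_norm z) (abs_nonneg _) (by norm_num)
        have h3 := mul_le_mul_of_nonneg_left h2 Real.two_pi_pos.le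
        have h4 : 0 ≤ ε * ‖z‖ := by positivity
        linarith
      have h2 : ‖h z‖ ≤ ‖fourierLaplace φ z‖ := by
        rw [← hh z, norm_mul]
        exact le_mul_of_one_le_left (norm_nonneg _) hz
      nlinarith
  · refine (memLp_congr_ae ?_).1 (Lp.memLp (𝓕 (hφ.toLp φ) : Lp ℂ 2 (volume : Measure ℝ)))
    filter_upwards [fourier_toLp_ae_eq hφ hi hb] with x hx
    rw [hx, mulX, hh]

theorem toL2_mk_eq {φ : ℝ → ℂ} (hφ : MemLp φ 2) (hb : ∀ t, φ t ≠ 0 → |t| ≤ 1 / 2)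
    {h : ℂ → ℂ} (hmem : h ∈ evenF2) (hh : ∀ z, z * h z = fourierLaplace φ z) :
    toL2 (EvenF2.mk h hmem) = 𝓕 (hφ.toLp φ) := by
  refine Lp.ext ((MemLp.coeFn_toLp (EvenF2.mk h hmem).memLp).trans ?_)
  filter_upwards [fourier_toLp_ae_eq hφ (integrable_of_bounded_support hφ hb) hb] with x hx
  rw [hx, ← hh]
  rfl

/-- Odd spectra supported in `[-1/2, 1/2]`. -/
def IsOddBandLimited (φ : Lp ℂ 2 (volume : Measure ℝ)) : Prop :=
  ∀ᵐ t : ℝ, (1 / 2 < |t| → φ t = 0) ∧ φ (-t) = -φ t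

/-- Every odd spectrum supported in `[-1/2, 1/2]` is realised by an element of `EvenF2`. -/
theorem IsOddBandLimited.exists_toL2_eq {u : Lp ℂ 2 (volume : Measure ℝ)}
    (hu : IsOddBandLimited u) :
    ∃ (f : EvenF2) (φ : ℝ → ℂ) (hφ : MemLp φ 2), (∀ t, φ t ≠ 0 → |t| ≤ 1 / 2) ∧
      (∀ᵐ t, φ (-t) = -φ t) ∧ (∀ z, z * f.fn z = fourierLaplace φ z) ∧ hφ.toLp φ = u ∧
      toL2 f = 𝓕 u := by
  -- Truncation gives a representative vanishing everywhere outside the band, not just almost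
  -- everywhere.
  set φ : ℝ → ℂ := indicator (Icc (-(1 / 2)) (1 / 2)) u with hφdef
  have hae : φ =ᵐ[volume] u := by
    filter_upwards [hu] with t ht
    by_cases h : t ∈ Icc (-(1 / 2) : ℝ) (1 / 2)
    · rw [hφdef, indicator_of_mem h]
    · rw [hφdef, indicator_of_notMem h, ht.1]
      by_contra h1
      exact h (abs_le.1 (not_lt.1 h1))
  have hφ : MemLp φ 2 := (memLp_congr_ae hae).2 (Lp.memLp u)
  have hb : ∀ t, φ t ≠ 0 → |t| ≤ 1 / 2 := fun t ht =>
    abs_le.2 (mem_of_indicator_ne_zero (s := Icc (-(1 / 2) : ℝ) (1 / 2)) ht)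
  have hodd : ∀ᵐ t, φ (-t) = -φ t := by
    have h1 := (Measure.measurePreserving_neg (volume : Measure ℝ)).quasiMeasurePreserving.ae hae
    filter_upwards [hu, hae, h1] with t ht h2 h3
    rw [h2, h3, ht.2]
  have hdL := differentiable_fourierLaplace (integrable_of_bounded_support hφ hb) hb
  -- Oddness forces a zero at the origin, so the divided slope there is an entire quotient by `z`.
  have hL0 : fourierLaplace φ 0 = 0 := by
    have := fourierLaplace_neg_of_odd hodd 0
    rw [neg_zero] at this
    exact self_eq_neg.1 this
  have hh (z : ℂ) : z * dslope (fourierLaplace φ) 0 z = fourierLaplace φ z := by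
    simpa [hL0] using sub_smul_dslope (fourierLaplace φ) 0 z
  have hd : Differentiable ℂ (dslope (fourierLaplace φ) 0) := by
    rw [← differentiableOn_univ] at hdL ⊢
    exact (differentiableOn_dslope univ_mem).2 hdL
  have hmem := mem_evenF2_of_mul_eq hφ hb hodd hd hh
  have hto : hφ.toLp φ = u := Lp.ext (hφ.coeFn_toLp.trans hae)
  exact ⟨EvenF2.mk _ hmem, φ, hφ, hb, hodd, hh, hto, hto ▸ toL2_mk_eq hφ hb hmem hh⟩

theorem HasExpTypeAtMost.id_mul {f : ℂ → ℂ} {τ : ℝ} (hf : HasExpTypeAtMost f τ) :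
    HasExpTypeAtMost (fun z => z * f z) τ := by
  intro ε hε
  obtain ⟨C, hC, h⟩ := hf (ε / 2) (by positivity)
  refine ⟨2 / ε * C, by positivity, fun z => ?_⟩
  have h2 : ‖z‖ ≤ 2 / ε * Real.exp (ε / 2 * ‖z‖) := by
    have := Real.add_one_le_exp (ε / 2 * ‖z‖)
    rw [div_mul_eq_mul_div, le_div_iff₀ hε]
    linarith
  rw [norm_mul]
  calc ‖z‖ * ‖f z‖
      ≤ 2 / ε * Real.exp (ε / 2 * ‖z‖) * (C * Real.exp ((τ + ε / 2) * ‖z‖)) :=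
        mul_le_mul h2 (h z) (norm_nonneg _) (by positivity)
    _ = 2 / ε * C * (Real.exp (ε / 2 * ‖z‖) * Real.exp ((τ + ε / 2) * ‖z‖)) := by ring
    _ = _ := by rw [← Real.exp_add]; ring_nf

theorem isOddBandLimited_fourierInv_toL2 (f : EvenF2) : IsOddBandLimited (𝓕⁻ (toL2 f)) := by
  have hodd : ∀ᵐ t : ℝ, (𝓕⁻ (toL2 f) : Lp ℂ 2 (volume : Measure ℝ)) (-t) =
      -(𝓕⁻ (toL2 f) : Lp ℂ 2 (volume : Measure ℝ)) t := by
    refine fourierInv_odd ?_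
    have h1 : toL2 f =ᵐ[volume] mulX f.fn := MemLp.coeFn_toLp f.memLp
    have h2 := (Measure.measurePreserving_neg (volume : Measure ℝ)).quasiMeasurePreserving.ae h1
    filter_upwards [h1, h2] with x hx hx'
    rw [hx, hx', mulX, mulX, ofReal_neg, f.fn_mem.2, neg_mul]
  -- Paley–Wiener with `π = 2π · (1/2)` clears the side `t < -1/2`; oddness carries this over to `t
  -- > 1/2`.
  have hlt := fourierInv_eq_zero_of_lt (g := fun z => z * f.fn z) (b := 1 / 2)
    (differentiable_id.mul f.fn_mem.1.1) (by norm_num)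
    ((show (π : ℝ) = 2 * π * (1 / 2) by ring) ▸ f.fn_mem.1.2.1.id_mul) f.memLp
  have hlt' := (Measure.measurePreserving_neg (volume : Measure ℝ)).quasiMeasurePreserving.ae hlt
  filter_upwards [hodd, hlt, hlt'] with t ht h1 h2
  refine ⟨fun hlt => ?_, ht⟩
  rcases lt_abs.1 hlt with h | h
  · have h3 := h2 (by simpa using h)
    have h4 : (𝓕⁻ (toL2 f) : Lp ℂ 2 (volume : Measure ℝ)) (-t) = 0 := h3
    rwa [ht, neg_eq_zero] at h4
  · exact h1 (by rw [mem_Iio]; linarith)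

theorem toL2_injective : Function.Injective toL2 :=
  (injective_iff_map_eq_zero toL2).2 eq_zero_of_toL2_eq_zero

/-- Every element of `EvenF2` comes from an odd spectrum supported in `[-1/2, 1/2]`. -/
theorem exists_spectrum (f : EvenF2) :
    ∃ (φ : ℝ → ℂ) (hφ : MemLp φ 2), (∀ t, φ t ≠ 0 → |t| ≤ 1 / 2) ∧ (∀ᵐ t, φ (-t) = -φ t) ∧
      (∀ z, z * f.fn z = fourierLaplace φ z) ∧ toL2 f = 𝓕 (hφ.toLp φ) := by
  obtain ⟨f', φ, hφ, hb, hodd, hh, hto, h⟩ :=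
    (isOddBandLimited_fourierInv_toL2 f).exists_toL2_eq
  have h1 : 𝓕 (𝓕⁻ (toL2 f)) = toL2 f := FourierTransform.fourier_fourierInv_eq _
  obtain rfl : f' = f := toL2_injective (h.trans h1)
  exact ⟨φ, hφ, hb, hodd, hh, by rw [hto, h1]⟩

theorem inner_eq_inner_toL2 (f g : EvenF2) : inner ℂ f g = inner ℂ (toL2 f) (toL2 g) := rfl

/-! ### Completeness -/

/-- An `L²` limit is an almost everywhere limit along a subsequence, and both conditions survive
pointwise limits at `t` and `-t`. -/
theorem isClosed_isOddBandLimited : IsClosed {u | IsOddBandLimited u} := by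
  refine IsSeqClosed.isClosed fun v u hv hlim => ?_
  obtain ⟨ns, -, hns⟩ := (tendstoInMeasure_of_tendsto_Lp hlim).exists_seq_tendsto_ae
  have hns' := (Measure.measurePreserving_neg (volume : Measure ℝ)).quasiMeasurePreserving.ae hns
  filter_upwards [hns, hns', ae_all_iff.2 hv] with t h1 h2 h3
  refine ⟨fun ht => tendsto_nhds_unique h1 ?_, tendsto_nhds_unique h2 ?_⟩
  · simp [fun n => (h3 (ns n)).1 ht]
  · simpa only [fun n => (h3 (ns n)).2] using h1.neg

theorem range_toL2 :
    range toL2 = (Lp.fourierTransformₗᵢ ℝ ℂ).symm ⁻¹' {u | IsOddBandLimited u} := by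
  ext v
  constructor
  · rintro ⟨f, rfl⟩
    exact isOddBandLimited_fourierInv_toL2 f
  · intro hv
    obtain ⟨f, -, -, -, -, -, -, h⟩ := IsOddBandLimited.exists_toL2_eq hv
    exact ⟨f, h.trans ((Lp.fourierTransformₗᵢ ℝ ℂ).apply_symm_apply v)⟩

theorem isometry_toL2 : Isometry toL2 := by
  refine AddMonoidHomClass.isometry_of_norm toL2 fun f => ?_
  rw [norm_eq_sqrt_re_inner (𝕜 := ℂ) f, inner_eq_inner_toL2, ← norm_eq_sqrt_re_inner]

instance completeSpace_evenF2 : CompleteSpace EvenF2 := by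
  rw [completeSpace_iff_isComplete_range isometry_toL2.isUniformInducing, range_toL2]
  exact (isClosed_isOddBandLimited.preimage
    (Lp.fourierTransformₗᵢ ℝ ℂ).symm.continuous).isComplete

/-! ### The spectrum of `z h_k` -/

theorem cos_pi_mul_half_of_odd {k : ℕ} (hk : Odd k) : Real.cos (π * k / 2) = 0 := by
  obtain ⟨m, rfl⟩ := hk
  rw [Real.cos_eq_zero_iff]
  exact ⟨m, by push_cast; ring⟩

theorem sin_pi_mul_half_sq_of_odd {k : ℕ} (hk : Odd k) : Real.sin (π * k / 2) ^ 2 = 1 := by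
  have := Real.sin_sq_add_cos_sq (π * k / 2)
  rw [cos_pi_mul_half_of_odd hk] at this
  linarith

/-- The spectrum of `z h_k(z)`. -/
def sineSpectrum (k : ℕ) : ℝ → ℂ := indicator (Icc (-(1 / 2)) (1 / 2)) fun t =>
  I * ((√2 * Real.sin (π * k / 2) * Real.sin (π * k * t) : ℝ) : ℂ)

theorem abs_le_of_sineSpectrum_ne_zero (k : ℕ) (t : ℝ) (ht : sineSpectrum k t ≠ 0) :
    |t| ≤ 1 / 2 := abs_le.2 (mem_of_indicator_ne_zero (s := Icc (-(1 / 2) : ℝ) (1 / 2)) ht)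

theorem memLp_sineSpectrum (k : ℕ) : MemLp (sineSpectrum k) 2 := by
  rw [sineSpectrum, memLp_indicator_iff_restrict measurableSet_Icc]
  have hc : Continuous fun t : ℝ =>
      I * ((√2 * Real.sin (π * k / 2) * Real.sin (π * k * t) : ℝ) : ℂ) := by fun_prop
  refine MemLp.of_bound hc.aestronglyMeasurable (√2 * 1 * 1) (ae_of_all _ fun t => ?_)
  rw [norm_mul, norm_I, one_mul, norm_real, Real.norm_eq_abs, abs_mul, abs_mul,
    abs_of_nonneg (Real.sqrt_nonneg 2)]
  gcongr
  · exact Real.abs_sin_le_one _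
  · exact Real.abs_sin_le_one _

theorem sineSpectrum_neg (k : ℕ) (t : ℝ) : sineSpectrum k (-t) = -sineSpectrum k t := by
  by_cases ht : t ∈ Icc (-(1 / 2) : ℝ) (1 / 2)
  · have ht' : -t ∈ Icc (-(1 / 2) : ℝ) (1 / 2) := ⟨by linarith [ht.2], by linarith [ht.1]⟩
    rw [sineSpectrum, indicator_of_mem ht, indicator_of_mem ht']
    simp
  · have ht' : -t ∉ Icc (-(1 / 2) : ℝ) (1 / 2) := fun h =>
      ht ⟨by linarith [h.2], by linarith [h.1]⟩
    rw [sineSpectrum, indicator_of_notMem ht, indicator_of_notMem ht', neg_zero]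

theorem hFun_neg (k : ℕ) (z : ℂ) : hFun k (-z) = hFun k z := by
  simp [hFun]

theorem fourierLaplace_sineSpectrum_eq (k : ℕ) (z : ℂ) :
    fourierLaplace (sineSpectrum k) z = I * (√2 * Complex.sin (π * k / 2)) *
      ∫ t in (-(1 / 2) : ℝ)..1 / 2, exp (-(2 * π * I * t * z)) * Complex.sin (π * k * t) := by
  rw [fourierLaplace_eq_intervalIntegral (by norm_num) (abs_le_of_sineSpectrum_ne_zero k),
    ← intervalIntegral.integral_const_mul]
  refine intervalIntegral.integral_congr fun t ht => ?_
  rw [uIcc_of_le (by norm_num)] at ht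
  simp only [sineSpectrum, indicator_of_mem ht]
  push_cast
  ring

theorem hasDerivAt_sin_mul (a : ℂ) (t : ℝ) :
    HasDerivAt (fun t : ℝ => Complex.sin (a * t)) (a * Complex.cos (a * t)) t := by
  have h := ((hasDerivAt_id (t : ℂ)).const_mul a).csin.comp_ofReal
  simpa [mul_comm] using h

theorem hasDerivAt_cos_mul (a : ℂ) (t : ℝ) :
    HasDerivAt (fun t : ℝ => Complex.cos (a * t)) (-(a * Complex.sin (a * t))) t := by
  have h := ((hasDerivAt_id (t : ℂ)).const_mul a).ccos.comp_ofReal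
  simpa [mul_comm] using h

theorem hasDerivAt_exp_mul (c : ℂ) (t : ℝ) :
    HasDerivAt (fun t : ℝ => exp (c * t)) (c * exp (c * t)) t := by
  have h := ((hasDerivAt_id (t : ℂ)).const_mul c).cexp.comp_ofReal
  simpa [mul_comm] using h

theorem integral_exp_mul_sin {a c : ℂ} (h : c ^ 2 + a ^ 2 ≠ 0) (ha : Complex.cos (a / 2) = 0) :
    ∫ t in (-(1 / 2) : ℝ)..1 / 2, exp (c * t) * Complex.sin (a * t) =
      2 * c * Complex.sin (a / 2) * Complex.cosh (c / 2) / (c ^ 2 + a ^ 2) := by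
  have hd (t : ℝ) : HasDerivAt (fun t : ℝ => exp (c * t) *
      (c * Complex.sin (a * t) - a * Complex.cos (a * t)) / (c ^ 2 + a ^ 2))
      (exp (c * t) * Complex.sin (a * t)) t := by
    refine (((hasDerivAt_exp_mul c t).mul (((hasDerivAt_sin_mul a t).const_mul c).fun_sub
      ((hasDerivAt_cos_mul a t).const_mul a))).div_const (c ^ 2 + a ^ 2)).congr_deriv ?_
    field_simp
    ring
  rw [intervalIntegral.integral_eq_sub_of_hasDerivAt (fun t _ => hd t)
    ((by fun_prop : Continuous fun t : ℝ =>
      exp (c * t) * Complex.sin (a * t)).intervalIntegrable _ _)]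
  push_cast
  have h1 (x : ℂ) : x * (1 / 2) = x / 2 := by ring
  have h2 (x : ℂ) : x * (-(1 / 2)) = -(x / 2) := by ring
  rw [h1, h2, h1, h2, Complex.cos_neg, Complex.sin_neg, ha, Complex.cosh]
  field_simp
  ring

/-- The case `c = -ia` excluded by the nonvanishing denominator in `integral_exp_mul_sin`; it
supplies the filled-in value of `h_k` at `k/2`. -/
theorem integral_exp_mul_sin_resonant {a : ℂ} (h : a ≠ 0) (ha : Complex.cos (a / 2) = 0) :
    ∫ t in (-(1 / 2) : ℝ)..1 / 2, exp (-(I * a) * t) * Complex.sin (a * t) = -I / 2 := by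
  have hd (t : ℝ) : HasDerivAt (fun t : ℝ => Complex.sin (a * t) * Complex.sin (a * t) / (2 * a) -
      I * ((t : ℂ) / 2 - Complex.sin (a * t) * Complex.cos (a * t) / (2 * a)))
      (exp (-(I * a) * t) * Complex.sin (a * t)) t := by
    have hs := hasDerivAt_sin_mul a t
    have hc := hasDerivAt_cos_mul a t
    have hx : HasDerivAt (fun t : ℝ => (t : ℂ)) 1 t := (hasDerivAt_id (t : ℂ)).comp_ofReal
    refine (((hs.mul hs).div_const (2 * a)).sub (((hx.div_const 2).sub
      ((hs.mul hc).div_const (2 * a))).const_mul I)).congr_deriv ?_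
    have h1 : exp (-(I * a) * t) = Complex.cos (a * t) - Complex.sin (a * t) * I := by
      rw [Complex.cos_sub_sin_I]
      ring_nf
    have h2 := Complex.sin_sq_add_cos_sq (a * t)
    rw [h1]
    field_simp
    linear_combination I * h2
  rw [intervalIntegral.integral_eq_sub_of_hasDerivAt (fun t _ => hd t)
    ((by fun_prop : Continuous fun t : ℝ =>
      exp (-(I * a) * t) * Complex.sin (a * t)).intervalIntegrable _ _)]
  push_cast
  have h1 (x : ℂ) : x * (1 / 2) = x / 2 := by ring
  have h2 (x : ℂ) : x * (-(1 / 2)) = -(x / 2) := by ring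
  rw [h1, h2, Complex.cos_neg, Complex.sin_neg, ha]
  ring

theorem ofReal_cos_half {k : ℕ} (hk : Odd k) : Complex.cos (π * k / 2) = 0 := by
  have := congrArg ofReal (cos_pi_mul_half_of_odd hk)
  push_cast at this
  exact this

theorem ofReal_sin_half_sq {k : ℕ} (hk : Odd k) : Complex.sin (π * k / 2) ^ 2 = 1 := by
  have := congrArg ofReal (sin_pi_mul_half_sq_of_odd hk)
  push_cast at this
  exact this

/-- Off `±k/2` this is the explicit integral of an exponential times a sine, with `sin(πk/2)² = 1`
removing the sign. At `k/2` the integral is resonant, and `-k/2` follows by parity. -/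
theorem mul_hFun_eq {k : ℕ} (hk : Odd k) (z : ℂ) :
    z * hFun k z = fourierLaplace (sineSpectrum k) z := by
  have hk0 : (k : ℂ) ≠ 0 := by
    have := hk.pos.ne'
    exact_mod_cast this
  have hπ : (π : ℂ) ≠ 0 := ofReal_ne_zero.2 Real.pi_ne_zero
  have hs := ofReal_sin_half_sq hk
  have hc := ofReal_cos_half hk
  by_cases hz : (k : ℂ) ^ 2 - 4 * z ^ 2 = 0
  · have hres : (k / 2 : ℂ) * hFun k (k / 2) = fourierLaplace (sineSpectrum k) (k / 2) := by
      rw [hFun, if_pos (by ring), fourierLaplace_sineSpectrum_eq]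
      have h1 := integral_exp_mul_sin_resonant (a := π * k) (mul_ne_zero hπ hk0) hc
      have h2 : ∫ t in (-(1 / 2) : ℝ)..1 / 2, exp (-(2 * π * I * t * (k / 2))) *
          Complex.sin (π * k * t) = -I / 2 := by
        rw [← h1]
        congr 1 with t
        congr 2
        ring
      rw [h2]
      generalize Complex.sin (π * k / 2) = s
      field_simp
      linear_combination s * I_sq
    have h3 : (z - k / 2) * (z + k / 2) = 0 := by linear_combination -hz / 4
    rcases mul_eq_zero.1 h3 with h | h
    · rw [sub_eq_zero.1 h, hres]
    · rw [eq_neg_of_add_eq_zero_left h, hFun_neg,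
        fourierLaplace_neg_of_odd (ae_of_all _ (sineSpectrum_neg k)), ← hres, neg_mul]
  · rw [hFun, if_neg hz, fourierLaplace_sineSpectrum_eq]
    have h0 : (-(2 * π * I * z)) ^ 2 + (π * k) ^ 2 = (π : ℂ) ^ 2 * ((k : ℂ) ^ 2 - 4 * z ^ 2) := by
      linear_combination 4 * (π : ℂ) ^ 2 * z ^ 2 * I_sq
    have h1 := integral_exp_mul_sin (a := π * k) (c := -(2 * π * I * z))
      (by rw [h0]; exact mul_ne_zero (pow_ne_zero 2 hπ) hz) hc
    have h2 : ∫ t in (-(1 / 2) : ℝ)..1 / 2, exp (-(2 * π * I * t * z)) *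
        Complex.sin (π * k * t) = _ := Eq.trans (by congr 1 with t; congr 2; ring) h1
    have h3 : Complex.cosh (-(2 * π * I * z) / 2) = Complex.cos (π * z) := by
      rw [← Complex.cosh_mul_I, ← Complex.cosh_neg]
      congr 1
      ring
    rw [h2, h0, h3]
    rw [← mul_div_assoc, ← mul_div_assoc,
      div_eq_div_iff (mul_ne_zero hπ hz) (mul_ne_zero (pow_ne_zero 2 hπ) hz)]
    linear_combination 4 * (√2 : ℂ) * z * Complex.cos (π * z) * π ^ 2 *
      ((k : ℂ) ^ 2 - 4 * z ^ 2) * (Complex.sin (π * k / 2) ^ 2 * I_sq - hs)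

/-- Away from `0` the function is an entire transform divided by `z`, so the singularities at `±k/2`
need no separate treatment. Near `0` the closed formula applies since `k ≠ 0`. -/
theorem differentiable_hFun {k : ℕ} (hk : Odd k) : Differentiable ℂ (hFun k) := by
  have hk0 : (k : ℂ) ≠ 0 := by
    have := hk.pos.ne'
    exact_mod_cast this
  have hL : Differentiable ℂ (fourierLaplace (sineSpectrum k)) := differentiable_fourierLaplace
    (integrable_of_bounded_support (memLp_sineSpectrum k) (abs_le_of_sineSpectrum_ne_zero k))
    (abs_le_of_sineSpectrum_ne_zero k)
  intro z
  by_cases hz : z = 0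
  · subst hz
    have hden : (k : ℂ) ^ 2 - 4 * (0 : ℂ) ^ 2 ≠ 0 := by simpa using hk0
    have hev : ∀ᶠ w : ℂ in 𝓝 0, (k : ℂ) ^ 2 - 4 * w ^ 2 ≠ 0 :=
      (by fun_prop : Continuous fun w : ℂ => (k : ℂ) ^ 2 - 4 * w ^ 2).continuousAt.eventually_ne hden
    have hπ : (π : ℂ) ≠ 0 := ofReal_ne_zero.2 Real.pi_ne_zero
    have hd : DifferentiableAt ℂ (fun w : ℂ => 4 * (√2 : ℂ) * Complex.cos (π * w) /
        (π * ((k : ℂ) ^ 2 - 4 * w ^ 2))) 0 :=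
      DifferentiableAt.div (by fun_prop) (by fun_prop) (mul_ne_zero hπ hden)
    refine hd.congr_of_eventuallyEq ?_
    filter_upwards [hev] with w hw
    rw [hFun, if_neg hw]
  · have hd : DifferentiableAt ℂ (fun w => fourierLaplace (sineSpectrum k) w / w) z :=
      (hL z).div differentiableAt_id hz
    refine hd.congr_of_eventuallyEq ?_
    filter_upwards [isOpen_ne.mem_nhds hz] with w hw
    rw [← mul_hFun_eq hk, mul_div_cancel_left₀ _ hw]

theorem hFun_mem {k : ℕ} (hk : Odd k) : hFun k ∈ evenF2 :=
  mem_evenF2_of_mul_eq (memLp_sineSpectrum k) (abs_le_of_sineSpectrum_ne_zero k)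
    (ae_of_all _ (sineSpectrum_neg k)) (differentiable_hFun hk) (mul_hFun_eq hk)

/-! ### Sampling, orthonormality and density -/

/-- The coefficients with respect to `h_j` are sampled values at half-integers. -/
theorem inner_hFun {j : ℕ} (hj : Odd j) (f : EvenF2) :
    inner ℂ (EvenF2.mk (hFun j) (hFun_mem hj)) f =
      √2 * Complex.sin (π * j / 2) * ((j / 2 : ℂ) * f.fn (j / 2)) := by
  obtain ⟨φ, hφ, hb, hodd, hh, hf⟩ := exists_spectrum f
  have hi := integrable_of_bounded_support hφ hb
  rw [inner_eq_inner_toL2, hf, toL2_mk_eq (memLp_sineSpectrum j)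
    (abs_le_of_sineSpectrum_ne_zero j) (hFun_mem hj) (mul_hFun_eq hj), Lp.inner_fourier_eq,
    L2.inner_def, hh]
  -- Antisymmetrising reduces the exponential kernel to `-i sin(πjt)`, which matches the conjugated
  -- spectrum of `h_j` pointwise.
  have h1 : (fourierLaplace φ (j / 2) : ℂ) =
      (fourierLaplace φ (j / 2) - fourierLaplace φ (-(j / 2))) / 2 := by
    rw [fourierLaplace_neg_of_odd hodd]
    ring
  rw [h1, fourierLaplace, fourierLaplace, ← integral_sub (integrable_kernel_mul hi hb _)
    (integrable_kernel_mul hi hb _), ← integral_div, ← integral_const_mul]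
  refine integral_congr_ae ?_
  filter_upwards [hφ.coeFn_toLp, (memLp_sineSpectrum j).coeFn_toLp] with t h2 h3
  rw [h2, h3, RCLike.inner_apply]
  by_cases ht : φ t = 0
  · simp [ht]
  have hmem : t ∈ Icc (-(1 / 2) : ℝ) (1 / 2) := abs_le.1 (hb t ht)
  rw [sineSpectrum, indicator_of_mem hmem, map_mul, conj_I, conj_ofReal]
  have h4 : exp (-(2 * π * I * t * (j / 2))) = Complex.cos (π * j * t) -
      Complex.sin (π * j * t) * I := by
    rw [Complex.cos_sub_sin_I]
    ring_nf
  have h5 : exp (-(2 * π * I * t * (-(j / 2)))) = Complex.cos (π * j * t) +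
      Complex.sin (π * j * t) * I := by
    rw [Complex.cos_add_sin_I]
    ring_nf
  rw [h4, h5]
  push_cast
  ring

theorem hFun_half {j k : ℕ} (hj : Odd j) :
    hFun k (j / 2) = if j = k then (√2 : ℂ) * Complex.sin (π * k / 2) / k else 0 := by
  have h1 : (k : ℂ) ^ 2 - 4 * (j / 2 : ℂ) ^ 2 = 0 ↔ j = k := by
    have h2 : (k : ℂ) ^ 2 - 4 * (j / 2 : ℂ) ^ 2 = (k : ℂ) ^ 2 - (j : ℂ) ^ 2 := by ring
    rw [h2, sub_eq_zero]
    norm_cast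
    rw [Nat.pow_left_inj two_ne_zero]
    exact eq_comm
  rw [hFun]
  by_cases h : j = k
  · rw [if_pos (h1.2 h), if_pos h]
  · rw [if_neg (fun h0 => h (h1.1 h0)), if_neg h]
    have h2 : (π * (j / 2) : ℂ) = π * j / 2 := by ring
    rw [h2, ofReal_cos_half hj]
    simp

theorem orthonormal_hFun : Orthonormal ℂ (fun k : {k : ℕ // Odd k} =>
    EvenF2.mk (hFun k) (hFun_mem k.2)) := by
  rw [orthonormal_iff_ite]
  rintro ⟨j, hj⟩ ⟨k, hk⟩
  rw [inner_hFun hj]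
  change _ * ((j / 2 : ℂ) * hFun k (j / 2)) = _
  rw [hFun_half hj]
  simp only [Subtype.mk.injEq]
  by_cases h : j = k
  · subst h
    have hj0 : (j : ℂ) ≠ 0 := by
      have := hj.pos.ne'
      exact_mod_cast this
    have h2 : (√2 : ℂ) ^ 2 = 2 := by
      rw [← ofReal_pow, Real.sq_sqrt zero_le_two, ofReal_ofNat]
    rw [if_pos rfl, if_pos rfl]
    field_simp
    linear_combination Complex.sin (π * j / 2) ^ 2 * h2 + 2 * ofReal_sin_half_sq hj
  · simp [h]

/-- An element of `EvenF2` which vanishes at all `j / 2` with `j` odd is zero. -/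
theorem eq_zero_of_fn_half_eq_zero (f : EvenF2) (h : ∀ j : ℕ, Odd j → f.fn (j / 2) = 0) :
    f = 0 := by
  obtain ⟨φ, hφ, hb, hodd, hh, hf⟩ := exists_spectrum f
  have h0 (j : ℕ) (hj : Odd j) : fourierLaplace φ (j / 2) = 0 := by
    rw [← hh, h j hj, mul_zero]
  have hφ0 : φ =ᵐ[volume] 0 := by
    refine ae_eq_zero_of_fourierLaplace_half hφ hb fun n => ?_
    -- For `n = m ≥ 0` the point is `(2m+1)/2`; for `n = -(m+1)` it is `-(2m+1)/2`, reached by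
    -- oddness. The split lists `n = 0` twice.
    obtain ⟨m, rfl | rfl⟩ := n.eq_nat_or_neg
    · rw [← h0 (2 * m + 1) ⟨m, rfl⟩]
      congr 1
      push_cast
      ring
    · rcases m with _ | m
      · rw [← h0 1 odd_one]
        congr 1
        simp
      · have h1 := fourierLaplace_neg_of_odd hodd ((2 * m + 1 : ℕ) / 2)
        rw [h0 _ ⟨m, rfl⟩, neg_zero] at h1
        rw [← h1]
        congr 1
        push_cast
        ring
  refine eq_zero_of_toL2_eq_zero f ?_
  have h2 : hφ.toLp φ = 0 := by
    rw [MemLp.toLp_eq_toLp_iff hφ MemLp.zero |>.2 hφ0, MemLp.toLp_zero]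
  rw [hf, h2]
  exact map_zero (Lp.fourierTransformₗᵢ ℝ ℂ)

/-- An element orthogonal to every `h_j` vanishes at every `j/2`, since the sampling factor `√2
sin(πj/2) j/2` is nonzero. -/
theorem topologicalClosure_span_hFun :
    (Submodule.span ℂ (range fun k : {k : ℕ // Odd k} =>
      EvenF2.mk (hFun k) (hFun_mem k.2))).topologicalClosure = ⊤ := by
  rw [Submodule.topologicalClosure_eq_top_iff, Submodule.eq_bot_iff]
  intro f hf
  refine eq_zero_of_fn_half_eq_zero f fun j hj => ?_
  have h1 := hf _ (Submodule.subset_span ⟨⟨j, hj⟩, rfl⟩)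
  rw [inner_hFun hj] at h1
  have hj0 : (j : ℂ) ≠ 0 := by
    have := hj.pos.ne'
    exact_mod_cast this
  have hs : Complex.sin (π * j / 2) ≠ 0 := by
    intro h0
    have := ofReal_sin_half_sq hj
    rw [h0] at this
    norm_num at this
  have h2 : (√2 : ℂ) ≠ 0 := ofReal_ne_zero.2 (Real.sqrt_ne_zero'.2 two_pos)
  exact ((mul_eq_zero.1 ((mul_eq_zero.1 h1).resolve_left (mul_ne_zero h2 hs))).resolve_left
    (div_ne_zero hj0 two_ne_zero))

end PaleyWienerEven

end

theorem mainTheorem4 :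
    CompleteSpace PaleyWienerEven.EvenF2 ∧
    ∃ hmem : ∀ k : {k : ℕ // Odd k}, PaleyWienerEven.hFun k ∈ PaleyWienerEven.evenF2,
      Orthonormal ℂ (fun k : {k : ℕ // Odd k} =>
        PaleyWienerEven.EvenF2.mk (PaleyWienerEven.hFun k) (hmem k)) ∧
      (Submodule.span ℂ (Set.range (fun k : {k : ℕ // Odd k} =>
        PaleyWienerEven.EvenF2.mk (PaleyWienerEven.hFun k) (hmem k)))).topologicalClosure = ⊤ :=
  ⟨PaleyWienerEven.completeSpace_evenF2, fun k => PaleyWienerEven.hFun_mem k.2,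
    PaleyWienerEven.orthonormal_hFun, PaleyWienerEven.topologicalClosure_span_hFun⟩
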